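/- Let $D\subset\mathbb{R}^k$ be a $C^2$ domain: a closed set with nonempty interior whose boundary $\partial D$ is an embedded $C^2$ hypersurface with outward pointing unit normal field $\nu$ (so near each boundary point $D=\{f\le 0\}$ for some $C^2$ function $f$ with $\nabla f\neq 0$, and $\nu=\nabla f/\|\nabla f\|$ there; $D$ need be neither compact nor connected). For $r\ge 0$ let $T(D,r)=\{y\in\mathbb{R}^k: d(y,D)\le r\}$, and let $$r_c(D)=\sup\{r\ge 0:\ \text{every } y \text{ with } d(y,D)\le r \text{ has a unique nearest point in } D\}\in[0,\infty].$$ For $1\le j\le k$ let $\mathcal{M}_j(D,\cdot)$ be the signed curvature measure on $\partial D$ $$\mathcal{M}_j(D,dx)=(j-1)!\,e_{j-1}\big(\kappa_1(x),\dots,\kappa_{k-1}(x)\big)\,d\mathcal{H}_{k-1}(x),$$ where $e_m$ is the $m$-th elementary symmetric polynomial, $\mathcal{H}_{k-1}$ is $(k-1)$-dimensional Hausdorff measure (normalized to agree with Lebesgue measure in dimension $k-1$), and $\kappa_1(x),\dots,\kappa_{k-1}(x)$ are the principal curvatures of $\partial D$ at $x$, i.e. the eigenvalues of the derivative $d\nu_x$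 on the tangent space $T_x\partial D$ (nonnegative if $D$ is convex). Put $\mathcal{M}_j(D,\cdot)=0$ for $j>k$, and let $\mathcal{M}_0(D,\cdot)$ be Lebesgue measure $\lambda$ on $D$, for which $\partial D$ is a null set. Suppose that $r_c(D)>0$ and that for every $0\le j\le k$ there is $\beta>0$ with $$\int_{\partial D}\frac{1}{1+\|x\|^\beta}\,|\mathcal{M}_j|(D,dx)<\infty .$$ Let $\varphi:\mathbb{R}^k\to\mathbb{R}$ be a Schwartz function, write $\frac{d^i\varphi}{d\nu^i}\big|_x$ for its $i$-th derivative at $x\in\partial D$ in the direction $\nu_x$, and for $l\ge 1$ let $$\mathcal{C}_l(D;\varphi)=\sum_{m=0}^{l-1}\int_{\partial D}\binom{l-1}{m}\frac{d^{\,l-1-m}\varphi}{d\nu^{\,l-1-m}}\Big|_x\,\mathcal{M}_{m+1}(D,dx).$$ Then all these integrals converge absolutely, and for every integer $n\ge 0$ there is a constant $K=K_n(D,\varphi)$, independent of $r$, such that for all $0<r<\min(r_c(D),1)$ $$\left|\int_{T(D,r)}\varphi\,d\lambda-\int_D\varphi\,d\lambda-\sum_{l=1}^{n+k}\frac{r^l}{l!}\,\mathcal{C}_l(D;\varphi)\right|<\frac{r^{n+2}}{(n+2)!}\,K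 .$$ -/

import Mathlib

open MeasureTheory Set Filter Topology
open scoped ENNReal NNReal SchwartzMap

noncomputable section

namespace TubeExpansion

/-- `k`-dimensional Euclidean space. -/
abbrev E (k : ℕ) : Type := EuclideanSpace ℝ (Fin k)

variable {k : ℕ}

/-! ### Domains with `C²` boundary and their outward unit normal -/

/-- `f` is a `C²` defining function of `D` near `p`: it is `C²` near `p`, its gradient at `p` does
not vanish, and `D = {f ≤ 0}` near `p`. -/
def IsLocalDefiningFunction (D : Set (E k)) (p : E k) (f : E k → ℝ) : Prop :=
  ContDiffAt ℝ 2 f p ∧ gradient f p ≠ 0 ∧ ∀ᶠ x in 𝓝 p, (x ∈ D ↔ f x ≤ 0)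

/-- A `C²` domain: a closed set with nonempty interior whose boundary is an embedded `C²`
hypersurface with an outward pointing unit normal, that is, near each boundary point `D` lies on
exactly one side of the hypersurface. Neither compactness nor connectedness is required. -/
structure IsC2Domain (D : Set (E k)) : Prop where
  isClosed : IsClosed D
  nonempty_interior : (interior D).Nonempty
  exists_local : ∀ p ∈ frontier D, ∃ f : E k → ℝ, IsLocalDefiningFunction D p f

/-- `v` is the outward pointing unit normal of `D` at `p`: the normalized gradient of a local
defining function. -/
def IsOutwardUnitNormal (D : Set (E k)) (p v : E k) : Prop :=
  ∃ f : E k → ℝ, IsLocalDefiningFunction D p f ∧ v = ‖gradient f p‖⁻¹ • gradient f p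

theorem eventually_pos_of_inner {f : E k → ℝ} {p u : E k} (hf : DifferentiableAt ℝ f p)
    (h0 : f p = 0) (hu : 0 < inner ℝ (gradient f p) u) :
    ∀ᶠ t : ℝ in 𝓝[>] 0, 0 < f (p + t • u) := by
  have h1 : HasFDerivAt f ((InnerProductSpace.toDual ℝ (E k)) (gradient f p)) (p + (0 : ℝ) • u) := by
    simpa using hf.hasGradientAt.hasFDerivAt
  have h2 : HasDerivAt (fun t : ℝ => p + t • u) u 0 := by
    simpa using ((hasDerivAt_id (0 : ℝ)).smul_const u).const_add p
  have h3 := (h1.comp_hasDerivAt (0 : ℝ) h2).tendsto_slope_zero_right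
  have h4 := h3.eventually_const_lt (u := 0) (by simpa using hu)
  filter_upwards [h4, self_mem_nhdsWithin] with t ht htp
  have htp' : (0 : ℝ) < t := htp
  simp only [Function.comp, zero_add, zero_smul, add_zero, h0, sub_zero, smul_eq_mul] at ht
  exact pos_of_mul_pos_right ht (inv_pos.mpr htp').le

theorem IsLocalDefiningFunction.eq_zero {D : Set (E k)} {p : E k} {f : E k → ℝ}
    (h : IsLocalDefiningFunction D p f) (hp : p ∈ frontier D) : f p = 0 := by
  obtain ⟨hf, -, hD⟩ := h
  have hc : ContinuousAt f p := hf.continuousAt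
  rcases lt_trichotomy (f p) 0 with hlt | h0 | hgt
  · exfalso
    refine hp.2 (mem_interior_iff_mem_nhds.mpr ?_)
    filter_upwards [hD, hc.eventually_lt_const hlt] with x hx hx' using hx.mpr hx'.le
  · exact h0
  · exfalso
    have h1 : ∃ᶠ x in 𝓝 p, x ∈ D := mem_closure_iff_frequently.mp hp.1
    refine h1 ?_
    filter_upwards [hD, hc.eventually_const_lt hgt] with x hx hx' hxD
    exact absurd (hx.mp hxD) (not_le.mpr hx')

theorem IsLocalDefiningFunction.not_inner_neg_pos {D : Set (E k)} {p u : E k} {f g : E k → ℝ}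
    (hp : p ∈ frontier D) (hf : IsLocalDefiningFunction D p f)
    (hg : IsLocalDefiningFunction D p g) (hu : 0 < inner ℝ (gradient f p) u) :
    0 ≤ inner ℝ (gradient g p) u := by
  by_contra! hneg
  have hf0 := hf.eq_zero hp
  have hg0 := hg.eq_zero hp
  obtain ⟨hf1, -, hf3⟩ := hf
  obtain ⟨hg1, -, hg3⟩ := hg
  have hgd : DifferentiableAt ℝ g p := hg1.differentiableAt (by norm_num)
  have h1 := eventually_pos_of_inner (hf1.differentiableAt (by norm_num)) hf0 hu
  have hgrad : gradient (fun x => -g x) p = -gradient g p := by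
    have h : HasGradientAt (fun x => -g x) (-gradient g p) p := by
      rw [hasGradientAt_iff_hasFDerivAt, map_neg]
      exact hgd.hasGradientAt.hasFDerivAt.neg
    exact h.gradient
  have h2 := eventually_pos_of_inner (f := fun x => -g x) (u := u) hgd.neg (by simp [hg0])
    (by rw [hgrad, inner_neg_left]; linarith)
  have hc : Tendsto (fun t : ℝ => p + t • u) (𝓝[>] 0) (𝓝 p) := by
    have : Tendsto (fun t : ℝ => p + t • u) (𝓝 0) (𝓝 (p + (0 : ℝ) • u)) :=
      Continuous.tendsto (by fun_prop) 0
    simpa using this.mono_left nhdsWithin_le_nhds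
  obtain ⟨t, h1, h2, h3, h4⟩ :=
    (h1.and (h2.and ((hc.eventually hf3).and (hc.eventually hg3)))).exists
  have h5 := h3.mp (h4.mpr (by linarith))
  linarith

/-- The outward unit normal at a boundary point does not depend on the defining function. -/
theorem IsOutwardUnitNormal.unique {D : Set (E k)} {p v w : E k} (hp : p ∈ frontier D)
    (hv : IsOutwardUnitNormal D p v) (hw : IsOutwardUnitNormal D p w) : v = w := by
  obtain ⟨f, hf, hvf⟩ := hv
  obtain ⟨g, hg, hwg⟩ := hw
  have hap : 0 < ‖gradient f p‖ := norm_pos_iff.mpr hf.2.1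
  have hbp : 0 < ‖gradient g p‖ := norm_pos_iff.mpr hg.2.1
  have hva : ‖v‖ = 1 := by
    rw [hvf, norm_smul, norm_inv, norm_norm, inv_mul_cancel₀ hap.ne']
  have hvb : ‖w‖ = 1 := by
    rw [hwg, norm_smul, norm_inv, norm_norm, inv_mul_cancel₀ hbp.ne']
  have hae : gradient f p = ‖gradient f p‖ • v := by
    rw [hvf, smul_smul, mul_inv_cancel₀ hap.ne', one_smul]
  have hbe : gradient g p = ‖gradient g p‖ • w := by
    rw [hwg, smul_smul, mul_inv_cancel₀ hbp.ne', one_smul]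
  by_contra hne
  have hlt : inner ℝ v w < 1 := by
    refine lt_of_le_of_ne ?_ (fun h => hne ((inner_eq_one_iff_of_norm_eq_one hva hvb).mp h))
    simpa [hva, hvb] using real_inner_le_norm v w
  have h1 : 0 < inner ℝ (gradient f p) (v - w) := by
    rw [hae, real_inner_smul_left, inner_sub_right, real_inner_self_eq_norm_sq, hva]
    exact mul_pos hap (by linarith)
  have h2 := hf.not_inner_neg_pos hp hg h1
  rw [hbe, real_inner_smul_left, inner_sub_right, real_inner_self_eq_norm_sq, hvb,
    real_inner_comm] at h2
  have h3 := nonneg_of_mul_nonneg_right h2 hbp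
  linarith

open Classical in
/-- The outward pointing unit normal field `ν` of `D` on its boundary (`0` where there is none). -/
def outwardNormal (D : Set (E k)) (p : E k) : E k :=
  if h : ∃ v, IsOutwardUnitNormal D p v then h.choose else 0

theorem IsC2Domain.isOutwardUnitNormal {D : Set (E k)} (hD : IsC2Domain D) {p : E k}
    (hp : p ∈ frontier D) : IsOutwardUnitNormal D p (outwardNormal D p) := by
  obtain ⟨f, hf⟩ := hD.exists_local p hp
  have h : ∃ v, IsOutwardUnitNormal D p v := ⟨_, f, hf, rfl⟩
  rw [outwardNormal, dif_pos h]
  exact h.choose_spec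

/-! ### Tubes and the critical radius -/

/-- The tube `T(D, r)` of points at distance at most `r` from `D`. -/
def tube (D : Set (E k)) (r : ℝ) : Set (E k) := {y | Metric.infDist y D ≤ r}

/-- Every point at distance at most `r` from `D` has a unique nearest point in `D`. -/
def HasUniqueProjection (D : Set (E k)) (r : ℝ) : Prop :=
  ∀ y : E k, Metric.infDist y D ≤ r → ∃! x, x ∈ D ∧ dist x y = Metric.infDist y D

/-- The critical radius `r_c(D)`, the supremum in `[0, ∞]` of the radii `r ≥ 0` such that every
point at distance at most `r` from `D` has a unique nearest point in `D`. -/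
def criticalRadius (D : Set (E k)) : ℝ≥0∞ :=
  ⨆ (r : ℝ≥0) (_ : HasUniqueProjection D r), (r : ℝ≥0∞)

/-! ### Curvature measures -/

/-- The tangent space at `p` of the boundary of `D`. -/
def tangentSpace (D : Set (E k)) (p : E k) : Submodule ℝ (E k) := (ℝ ∙ outwardNormal D p)ᗮ

/-- The shape operator of the boundary of `D` at `p`, as an endomorphism of the tangent space: the
tangential part of the derivative of the outward unit normal along the boundary. Its eigenvalues
are the principal curvatures, which are nonnegative when `D` is convex. -/
def shapeOperator (D : Set (E k)) (p : E k) : tangentSpace D p →ₗ[ℝ] tangentSpace D p :=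
  ((tangentSpace D p).orthogonalProjectionOnto ∘L
    fderivWithin ℝ (outwardNormal D) (frontier D) p ∘L (tangentSpace D p).subtypeL).toLinearMap

/-- The `m`-th elementary symmetric polynomial `e_m` of the eigenvalues (with multiplicity) of an
endomorphism `A`, i.e. the coefficient of `t ^ m` in `det (1 + t A)`. -/
def elemSymm {V : Type*} [AddCommGroup V] [Module ℝ V] [FiniteDimensional ℝ V]
    (A : V →ₗ[ℝ] V) (m : ℕ) : ℝ :=
  (-A).charpoly.reverse.coeff m

theorem det_one_add_smul {V : Type*} [AddCommGroup V] [Module ℝ V] [FiniteDimensional ℝ V]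
    (A : V →ₗ[ℝ] V) (t : ℝ) :
    LinearMap.det (1 + t • A) = ∑ m ∈ Finset.range (Module.finrank ℝ V + 1), elemSymm A m * t ^ m := by
  have hdeg : (-A).charpoly.reverse.natDegree < Module.finrank ℝ V + 1 := by
    have := Polynomial.reverse_natDegree_le (-A).charpoly
    rw [LinearMap.charpoly_natDegree] at this
    omega
  have hsum : ∑ m ∈ Finset.range (Module.finrank ℝ V + 1), elemSymm A m * t ^ m
      = (-A).charpoly.reverse.eval t := (Polynomial.eval_eq_sum_range' hdeg t).symm
  rw [hsum]
  rcases eq_or_ne t 0 with rfl | ht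
  · simp [← Polynomial.coeff_zero_eq_eval_zero, (LinearMap.charpoly_monic (-A)).leadingCoeff]
  · let _ : Invertible t⁻¹ := invertibleOfNonzero (inv_ne_zero ht)
    have h := Polynomial.eval₂_reverse_mul_pow (RingHom.id ℝ) t⁻¹ (-A).charpoly
    rw [invOf_eq_inv, inv_inv, LinearMap.charpoly_natDegree] at h
    change Polynomial.eval t (-A).charpoly.reverse * _ = Polynomial.eval t⁻¹ (-A).charpoly at h
    rw [LinearMap.eval_charpoly, sub_neg_eq_add] at h
    have h2 : (1 : V →ₗ[ℝ] V) + t • A = t • (algebraMap ℝ (V →ₗ[ℝ] V) t⁻¹ + A) := by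
      rw [smul_add, Algebra.algebraMap_eq_smul_one, smul_smul, mul_inv_cancel₀ ht, one_smul]
    rw [h2, LinearMap.det_smul, ← h, mul_comm, mul_assoc, ← mul_pow, inv_mul_cancel₀ ht, one_pow,
      mul_one]

theorem elemSymm_eq_zero {V : Type*} [AddCommGroup V] [Module ℝ V] [FiniteDimensional ℝ V]
    (A : V →ₗ[ℝ] V) {m : ℕ} (hm : Module.finrank ℝ V < m) : elemSymm A m = 0 := by
  apply Polynomial.coeff_eq_zero_of_natDegree_lt
  have := Polynomial.reverse_natDegree_le (-A).charpoly
  rw [LinearMap.charpoly_natDegree] at this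
  omega

/-- The density, with respect to the `(k - 1)`-dimensional Hausdorff measure on the boundary of `D`,
of the restriction to that boundary of the signed curvature measure (Minkowski functional)
`M_j(D, ·)` of Euclidean space. For `j = m + 1` it is `m!` times the `m`-th elementary symmetric
polynomial of the principal curvatures, which vanishes for `j > k`. The measure `M_0(D, ·)` is
Lebesgue measure on `D`, for which the boundary is a null set. -/
def minkowskiDensity (D : Set (E k)) : ℕ → E k → ℝ
  | 0, _ => 0
  | m + 1, p => m.factorial * elemSymm (shapeOperator D p) m

/-- A function `g` is integrable on the boundary of `D` with respect to the total variation of the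
curvature measure `M_j(D, ·)`. -/
def MinkowskiIntegrable (D : Set (E k)) (j : ℕ) (g : E k → ℝ) : Prop :=
  IntegrableOn (fun x => g x * minkowskiDensity D j x) (frontier D) μHE[k - 1]

/-- The integral of `g` over the boundary of `D` against the curvature measure `M_j(D, ·)`. -/
def minkowskiIntegral (D : Set (E k)) (j : ℕ) (g : E k → ℝ) : ℝ :=
  ∫ x in frontier D, g x * minkowskiDensity D j x ∂μHE[k - 1]

/-! ### The coefficients of the expansion -/

/-- The iterated derivative `d^i φ / dν^i` of `φ` at `x`, in the direction of the outward unit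
normal at `x`. -/
def normalDeriv (D : Set (E k)) (φ : 𝓢(E k, ℝ)) (i : ℕ) (x : E k) : ℝ :=
  iteratedFDeriv ℝ i φ x (fun _ => outwardNormal D x)

/-- The coefficient `C_l(D; φ)` of `r ^ l / l!`, for `l ≥ 1`. -/
def tubeCoeff (D : Set (E k)) (φ : 𝓢(E k, ℝ)) (l : ℕ) : ℝ :=
  ∑ m ∈ Finset.range l,
    minkowskiIntegral D (m + 1) (fun x => (l - 1).choose m * normalDeriv D φ (l - 1 - m) x)

end TubeExpansion

end

namespace TubeExpansion

variable {k : ℕ} {D : Set (E k)} {p x y : E k} {f : E k → ℝ}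

/-! ### Local structure of a `C²` boundary -/

/-! For `r` below the critical radius, the normal exponential map `(x, t) ↦ x + t ν(x)` is a
bijection from `∂D × (0, r]` onto `T(D, r) \ D`, with Jacobian `det (1 + t S_x)`, where `S_x` is the
shape operator. This determinant is a polynomial in `t` whose coefficients are the curvature
densities divided by factorials. Hence the tube integral is a finite sum of integrals of `t ^ m / m!
· φ(x + t ν(x))` against curvature measures. Taylor expansion of `φ` along the normal and
integration in `t` give the coefficients. The remainder is controlled because Schwartz decay,
uniform over shifts of length at most `1`, beats the polynomial growth allowed by the integrability
hypothesis.

Three points need work. Surjectivity is the first-order condition at a nearest point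
(`IsC2Domain.sub_eq_smul_outwardNormal`). Injectivity requires that every normal segment of length
`t < r_c` realizes the distance `t` (`IsC2Domain.infDist_add_smul_outwardNormal`). This follows by
prolonging short segments inside the region of unique nearest points, then by density and continuity
of `ν`. The same fact bounds the principal curvatures from below, so the Jacobian is nonnegative and
no absolute value spoils its polynomial form.

Finally, the change of variables concerns Hausdorff measure on a hypersurface. In a graph chart over
the tangent hyperplane, with Lipschitz constant close to `1`, surface measure times length is nearly
Lebesgue measure, and the Euclidean change of variables applies. The local estimates, exact up to
`ε`, are glued into a density statement by `MeasureTheory.Measure.eq_withDensity_of_forall_nhds`. -/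

theorem _root_.ContDiffAt.gradient_one {f : E k → ℝ} {p : E k} (hf : ContDiffAt ℝ 2 f p) :
    ContDiffAt ℝ 1 (gradient f) p := by
  have h : ContDiffAt ℝ 1 (fderiv ℝ f) p := hf.fderiv_right (by norm_num)
  exact (InnerProductSpace.toDual ℝ (E k)).symm.contDiff.contDiffAt.comp p h

theorem IsLocalDefiningFunction.eventually (h : IsLocalDefiningFunction D p f) :
    ∀ᶠ x in 𝓝 p, IsLocalDefiningFunction D x f := by
  obtain ⟨h1, h2, h3⟩ := h
  filter_upwards [h1.eventually (by simp), h1.gradient_one.continuousAt.eventually_ne h2,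
    h3.eventually_nhds] with x hx1 hx2 hx3 using ⟨hx1, hx2, hx3⟩

theorem IsLocalDefiningFunction.mem_frontier (h : IsLocalDefiningFunction D p f) (h0 : f p = 0) :
    p ∈ frontier D := by
  refine ⟨subset_closure (h.2.2.self_of_nhds.mpr h0.le), fun hint => ?_⟩
  have hpos := eventually_pos_of_inner (h.1.differentiableAt (by norm_num)) h0
    (u := gradient f p) (by rw [real_inner_self_eq_norm_sq]; have := norm_pos_iff.mpr h.2.1; positivity)
  have hc : Tendsto (fun t : ℝ => p + t • gradient f p) (𝓝[>] 0) (𝓝 p) := by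
    have : Tendsto (fun t : ℝ => p + t • gradient f p) (𝓝 0) (𝓝 (p + (0 : ℝ) • gradient f p)) :=
      Continuous.tendsto (by fun_prop) 0
    simpa using this.mono_left nhdsWithin_le_nhds
  obtain ⟨t, h1, h2, h3⟩ := (hpos.and ((hc.eventually h.2.2).and
    (hc.eventually (mem_interior_iff_mem_nhds.mp hint)))).exists
  linarith [h2.mp h3]

theorem IsLocalDefiningFunction.outwardNormal_eq (h : IsLocalDefiningFunction D p f)
    (hp : p ∈ frontier D) : outwardNormal D p = ‖gradient f p‖⁻¹ • gradient f p := by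
  have hv : ∃ v, IsOutwardUnitNormal D p v := ⟨_, f, h, rfl⟩
  have : IsOutwardUnitNormal D p (outwardNormal D p) := by
    rw [outwardNormal, dif_pos hv]
    exact hv.choose_spec
  exact this.unique hp ⟨f, h, rfl⟩

theorem IsC2Domain.norm_outwardNormal (hD : IsC2Domain D) (hp : p ∈ frontier D) :
    ‖outwardNormal D p‖ = 1 := by
  obtain ⟨f, hf⟩ := hD.exists_local p hp
  rw [hf.outwardNormal_eq hp, norm_smul, norm_inv, norm_norm,
    inv_mul_cancel₀ (norm_pos_iff.mpr hf.2.1).ne']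

/-- A single defining function serves at all nearby boundary points, so its normalized gradient is a
`C¹` extension of `ν` to an open set. Ordinary derivatives of the extension then replace derivatives
along the boundary. -/
theorem IsC2Domain.exists_normal_extension (hD : IsC2Domain D) (hp : p ∈ frontier D) :
    ∃ N : E k → E k, ContDiffAt ℝ 1 N p ∧ ∀ᶠ x in 𝓝 p, x ∈ frontier D → outwardNormal D x = N x := by
  obtain ⟨f, hf⟩ := hD.exists_local p hp
  refine ⟨fun x => ‖gradient f x‖⁻¹ • gradient f x, ?_, ?_⟩
  · have hg := hf.1.gradient_one
    exact ((hg.norm ℝ hf.2.1).inv (norm_ne_zero_iff.mpr hf.2.1)).smul hg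
  · filter_upwards [hf.eventually] with x hx hxD using hx.outwardNormal_eq hxD

theorem IsC2Domain.continuousOn_outwardNormal (hD : IsC2Domain D) :
    ContinuousOn (outwardNormal D) (frontier D) := by
  intro p hp
  obtain ⟨N, hN, heq⟩ := hD.exists_normal_extension hp
  refine hN.continuousAt.continuousWithinAt.congr_of_eventuallyEq ?_ (heq.self_of_nhds hp)
  filter_upwards [mem_nhdsWithin_of_mem_nhds heq, self_mem_nhdsWithin] with x hx hx' using hx hx'

/-- The map `x ↦ x - ⟨n, x⟩ n`, which for a unit vector `n` is the orthogonal projection onto the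
hyperplane orthogonal to `n`. -/
noncomputable def perp (n : E k) : E k →L[ℝ] E k :=
  ContinuousLinearMap.id ℝ (E k) - (innerSL ℝ n).smulRight n

@[simp] theorem perp_apply (n x : E k) : perp n x = x - inner ℝ n x • n := rfl

theorem inner_perp {n : E k} (hn : ‖n‖ = 1) (x : E k) : inner ℝ n (perp n x) = 0 := by
  rw [perp_apply, inner_sub_right, real_inner_smul_right, real_inner_self_eq_norm_sq, hn]
  ring

theorem norm_perp_le {n : E k} (hn : ‖n‖ = 1) (x : E k) : ‖perp n x‖ ≤ ‖x‖ := by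
  refine le_of_sq_le_sq ?_ (norm_nonneg x)
  have h1 : inner ℝ (perp n x) (perp n x) = inner ℝ x (perp n x) := by
    conv_lhs => rw [perp_apply n x, inner_sub_left, real_inner_smul_left, ← perp_apply n x,
      inner_perp hn]
    ring
  rw [← real_inner_self_eq_norm_sq, h1, perp_apply, inner_sub_right, real_inner_smul_right,
    real_inner_self_eq_norm_sq, real_inner_comm]
  nlinarith [sq_nonneg (inner ℝ x n)]

/-- Near a boundary point the boundary is a graph over its tangent hyperplane: there is a `C¹` map
`Ψ`, tangent to the identity, which inverts the orthogonal projection onto the hyperplane. -/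
theorem IsC2Domain.exists_graph_chart (hD : IsC2Domain D) (hp : p ∈ frontier D) :
    ∃ Ψ : E k → E k, ContDiffAt ℝ 1 Ψ (perp (outwardNormal D p) p) ∧
      HasFDerivAt Ψ (ContinuousLinearMap.id ℝ (E k)) (perp (outwardNormal D p) p) ∧
      (∀ᶠ x in 𝓝 p, x ∈ frontier D → Ψ (perp (outwardNormal D p) x) = x) ∧
      ∀ᶠ z in 𝓝 (perp (outwardNormal D p) p), inner ℝ (outwardNormal D p) z = 0 →
        Ψ z ∈ frontier D := by
  obtain ⟨f, hf⟩ := hD.exists_local p hp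
  set n := outwardNormal D p with hn
  have hn1 : ‖n‖ = 1 := hD.norm_outwardNormal hp
  have ha : 0 < ‖gradient f p‖ := norm_pos_iff.mpr hf.2.1
  set a := ‖gradient f p‖ with hadef
  have hgrad : gradient f p = a • n := by
    rw [hn, hf.outwardNormal_eq hp, smul_smul, mul_inv_cancel₀ ha.ne', one_smul]
  have hfp := hf.eq_zero hp
  -- The normal coordinate is replaced by `f / a`, which has the same derivative at `p`. So `Φ` has
  -- derivative the identity there and equals `perp n` on the boundary; its local inverse is the
  -- chart.
  let Φ : E k → E k := fun x => perp n x + (a⁻¹ * f x) • n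
  have hΦ : ContDiffAt ℝ 1 Φ p := by
    have h1 : ContDiffAt ℝ 1 f p := hf.1.of_le (by norm_num)
    exact (perp n).contDiff.contDiffAt.add ((contDiffAt_const.mul h1).smul contDiffAt_const)
  have hΦ' : HasFDerivAt Φ ((ContinuousLinearEquiv.refl ℝ (E k) : E k ≃L[ℝ] E k) : E k →L[ℝ] E k) p := by
    have h1 := (hf.1.differentiableAt (by norm_num)).hasGradientAt.hasFDerivAt
    have h2 := (perp n).hasFDerivAt (x := p) |>.add ((h1.const_mul a⁻¹).smul_const n)
    refine h2.congr_fderiv ?_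
    ext1 v
    simp [hgrad, ha.ne']
  have hΦp : Φ p = perp n p := by simp [Φ, hfp]
  have hs := hΦ.hasStrictFDerivAt' hΦ' (by norm_num)
  have hl := hs.eventually_left_inverse
  have hr := hs.eventually_right_inverse
  have ht := hs.localInverse_tendsto
  have hsi := hs.to_localInverse
  have hci : ContDiffAt ℝ 1 (hs.localInverse Φ _ p) (Φ p) := hΦ.to_localInverse hΦ' (by norm_num)
  rw [hΦp] at hr ht hsi hci
  refine ⟨hs.localInverse Φ _ p, hci, hsi.hasFDerivAt, ?_, ?_⟩
  · filter_upwards [hl, hf.eventually] with x hx hfx hxD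
    have : Φ x = perp n x := by simp [Φ, hfx.eq_zero hxD]
    rw [← this, hx]
  · filter_upwards [hr, ht.eventually hf.eventually] with z hz hfz hzn
    refine hfz.mem_frontier ?_
    have h3 : inner ℝ n (Φ (hs.localInverse Φ _ p z)) = 0 := by rw [hz, hzn]
    simp only [Φ] at h3
    rw [inner_add_right, inner_perp hn1, real_inner_smul_right, real_inner_self_eq_norm_sq, hn1] at h3
    have h4 : a⁻¹ * f (hs.localInverse Φ _ p z) = 0 := by linarith
    exact (mul_eq_zero.mp h4).resolve_left (inv_pos.mpr ha).ne'

/-- Every tangent vector of the boundary is the velocity of a curve in the boundary. -/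
theorem IsC2Domain.exists_curve (hD : IsC2Domain D) (hp : p ∈ frontier D) {v : E k}
    (hv : inner ℝ (outwardNormal D p) v = 0) :
    ∃ c : ℝ → E k, c 0 = p ∧ HasDerivAt c v 0 ∧ ∀ᶠ t in 𝓝 0, c t ∈ frontier D := by
  obtain ⟨Ψ, -, h1, h2, h3⟩ := hD.exists_graph_chart hp
  set n := outwardNormal D p
  have hn1 : ‖n‖ = 1 := hD.norm_outwardNormal hp
  have hl : HasDerivAt (fun t : ℝ => perp n p + t • v) v 0 := by
    simpa using ((hasDerivAt_id (0 : ℝ)).smul_const v).const_add (perp n p)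
  refine ⟨fun t => Ψ (perp n p + t • v), ?_, ?_, ?_⟩
  · simpa using h2.self_of_nhds hp
  · have h1' : HasFDerivAt Ψ (ContinuousLinearMap.id ℝ (E k)) (perp n p + (0 : ℝ) • v) := by
      simpa using h1
    exact h1'.comp_hasDerivAt (0 : ℝ) hl
  · have hc : Tendsto (fun t : ℝ => perp n p + t • v) (𝓝 0) (𝓝 (perp n p)) := by
      simpa using hl.continuousAt.tendsto
    filter_upwards [hc.eventually h3] with t ht
    refine ht ?_
    rw [inner_add_right, inner_perp hn1, real_inner_smul_right, hv]
    ring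

/-! ### Nearest points -/

/-- The segment from a nearest point of `D` to a point outside of `D` is normal to the boundary. -/
theorem IsC2Domain.sub_eq_smul_outwardNormal (hD : IsC2Domain D) (hp : p ∈ frontier D)
    (h : ∀ x ∈ D, ‖y - p‖ ≤ ‖y - x‖) : y - p = ‖y - p‖ • outwardNormal D p := by
  obtain ⟨f, hf⟩ := hD.exists_local p hp
  set n := outwardNormal D p with hn
  have hn1 : ‖n‖ = 1 := hD.norm_outwardNormal hp
  have ha : 0 < ‖gradient f p‖ := norm_pos_iff.mpr hf.2.1
  have hgrad : gradient f p = ‖gradient f p‖ • n := by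
    rw [hn, hf.outwardNormal_eq hp, smul_smul, mul_inv_cancel₀ ha.ne', one_smul]
  have hfp := hf.eq_zero hp
  -- Small steps in a direction pointing strictly into `D` stay in `D`, so they cannot decrease the
  -- distance to `y` to first order.
  have key : ∀ w : E k, inner ℝ n w < 0 → inner ℝ (y - p) w ≤ 0 := by
    intro w hw
    have hfd : DifferentiableAt ℝ f p := hf.1.differentiableAt (by norm_num)
    have hg : gradient (fun x => -f x) p = -gradient f p := by
      have h : HasGradientAt (fun x => -f x) (-gradient f p) p := by
        rw [hasGradientAt_iff_hasFDerivAt, map_neg]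
        exact hfd.hasGradientAt.hasFDerivAt.neg
      exact h.gradient
    have h1 := eventually_pos_of_inner (f := fun x => -f x) (u := w) hfd.neg (by simp [hfp])
      (by rw [hg, inner_neg_left, hgrad, real_inner_smul_left]; nlinarith)
    have hc : Tendsto (fun t : ℝ => p + t • w) (𝓝[>] 0) (𝓝 p) := by
      have : Tendsto (fun t : ℝ => p + t • w) (𝓝 0) (𝓝 (p + (0 : ℝ) • w)) :=
        Continuous.tendsto (by fun_prop) 0
      simpa using this.mono_left nhdsWithin_le_nhds
    have h2 : ∀ᶠ t : ℝ in 𝓝[>] 0, 2 * inner ℝ (y - p) w ≤ t * ‖w‖ ^ 2 := by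
      filter_upwards [h1, hc.eventually hf.2.2, self_mem_nhdsWithin] with t ht1 ht2 ht3
      have ht3' : (0 : ℝ) < t := ht3
      have h3 := h _ (ht2.mpr (by linarith))
      have h4 : ‖y - (p + t • w)‖ ^ 2
          = ‖y - p‖ ^ 2 - 2 * (t * inner ℝ (y - p) w) + t ^ 2 * ‖w‖ ^ 2 := by
        rw [← sub_sub, norm_sub_sq_real, real_inner_smul_right, norm_smul, mul_pow,
          Real.norm_eq_abs, sq_abs]
      have h5 : ‖y - p‖ ^ 2 ≤ ‖y - (p + t • w)‖ ^ 2 := by gcongr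
      rw [h4] at h5
      have : t * (2 * inner ℝ (y - p) w) ≤ t * (t * ‖w‖ ^ 2) := by nlinarith
      exact le_of_mul_le_mul_left this ht3'
    have h3 : Tendsto (fun t : ℝ => t * ‖w‖ ^ 2) (𝓝[>] 0) (𝓝 0) := by
      have : Tendsto (fun t : ℝ => t * ‖w‖ ^ 2) (𝓝 0) (𝓝 (0 * ‖w‖ ^ 2)) :=
        Continuous.tendsto (by fun_prop) 0
      simpa using this.mono_left nhdsWithin_le_nhds
    linarith [ge_of_tendsto h3 h2]
  set u := y - p
  by_contra hne
  have hu0 : 0 < ‖u‖ := by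
    rcases (norm_nonneg u).eq_or_lt with h0 | h0
    · exact absurd (by rw [← h0, zero_smul]; exact norm_eq_zero.mp h0.symm) hne
    · exact h0
  have hle : inner ℝ n u ≤ ‖u‖ := by simpa [hn1] using real_inner_le_norm n u
  have hlt : inner ℝ n u < ‖u‖ := by
    refine lt_of_le_of_ne hle fun heq => hne ?_
    have h6 : ‖u - ‖u‖ • n‖ ^ 2 = 0 := by
      rw [norm_sub_sq_real, real_inner_smul_right, real_inner_comm, heq, norm_smul, hn1, norm_norm]
      ring
    exact sub_eq_zero.mp (norm_eq_zero.mp (pow_eq_zero_iff (two_ne_zero) |>.mp h6))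
  -- Unless `u` is a nonnegative multiple of `n`, this vector points into `D`, yet its inner product
  -- with `u` is `‖u‖ (‖u‖ - ⟨n, u⟩) > 0`.
  have h7 := key (u - ‖u‖ • n) (by
    rw [inner_sub_right, real_inner_smul_right, real_inner_self_eq_norm_sq, hn1]; linarith)
  rw [inner_sub_right, real_inner_smul_right, real_inner_self_eq_norm_sq, real_inner_comm] at h7
  nlinarith

end TubeExpansion

namespace TubeExpansion

variable {k : ℕ} {D : Set (E k)} {p x y : E k} {r s t : ℝ}

/-! ### Sets with unique nearest points -/

theorem hasUniqueProjection_of_lt (h : ENNReal.ofReal r < criticalRadius D) :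
    HasUniqueProjection D r := by
  simp only [criticalRadius, lt_iSup_iff] at h
  obtain ⟨s, hs, hrs⟩ := h
  have hrs' : r ≤ s := (ENNReal.ofReal_le_ofReal_iff s.coe_nonneg).mp
    (by rw [ENNReal.ofReal_coe_nnreal]; exact hrs.le)
  exact fun y hy => hs y (hy.trans hrs')

/-- Nearest points depend continuously on the point, where the nearest point is unique. -/
theorem exists_nearest_close (hD : IsClosed D)
    (huniq : ∀ x' ∈ D, dist x' y = Metric.infDist y D → x' = x) {ε : ℝ} (hε : 0 < ε) :
    ∃ δ > 0, ∀ y', dist y' y < δ → ∀ x' ∈ D, dist x' y' = Metric.infDist y' D → dist x' x < ε := by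
  set d := Metric.infDist y D with hd
  -- On the compact set `C` of candidates at distance at least `ε` from `x`, the distance to `y`
  -- exceeds `d` by a positive gap. A nearest point of `y'` lies within `d + 2 dist y' y` of `y`,
  -- hence outside `C` once `y'` is close to `y`.
  let C : Set (E k) := D ∩ Metric.closedBall y (d + 1) ∩ {x' | ε ≤ dist x' x}
  have hC : IsCompact C :=
    (isCompact_closedBall y (d + 1)).inter_left hD |>.inter_right
      (isClosed_le continuous_const (continuous_id.dist continuous_const))
  have step : ∀ y' x', dist x' y' = Metric.infDist y' D →
      dist x' y ≤ d + 2 * dist y' y := by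
    intro y' x' h
    have h1 : dist x' y ≤ dist x' y' + dist y' y := dist_triangle _ _ _
    have h2 : Metric.infDist y' D ≤ Metric.infDist y D + dist y' y := Metric.infDist_le_infDist_add_dist
    linarith
  rcases C.eq_empty_or_nonempty with hemp | hne
  · refine ⟨1 / 2, by norm_num, fun y' hy' x' hx' h => ?_⟩
    by_contra! hle
    have : x' ∈ C := ⟨⟨hx', by
      have := step y' x' h
      rw [Metric.mem_closedBall]; linarith⟩, hle⟩
    rw [hemp] at this
    exact this
  · obtain ⟨m, hmC, hm⟩ := hC.exists_isMinOn hne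
      (f := fun x' => dist x' y) (continuous_id.dist continuous_const).continuousOn
    have hmd : d < dist m y := by
      have h1 : d ≤ dist m y := by
        rw [hd, dist_comm]; exact Metric.infDist_le_dist_of_mem hmC.1.1
      refine lt_of_le_of_ne h1 fun heq => ?_
      have h2 : m = x := huniq m hmC.1.1 heq.symm
      have h3 : ε ≤ dist m x := hmC.2
      rw [h2, dist_self] at h3
      linarith
    refine ⟨min (1 / 2) ((dist m y - d) / 2), by
      apply lt_min <;> linarith, fun y' hy' x' hx' h => ?_⟩
    by_contra! hle
    have h4 := step y' x' h
    have h5 : dist y' y < (dist m y - d) / 2 := hy'.trans_le (min_le_right _ _)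
    have h6 : dist y' y < 1 / 2 := hy'.trans_le (min_le_left _ _)
    have h7 : x' ∈ C := ⟨⟨hx', by rw [Metric.mem_closedBall]; linarith⟩, hle⟩
    have h8 : dist m y ≤ dist x' y := hm h7
    linarith

/-- The distance to `D` grows at unit rate in the direction away from the unique nearest point. -/
theorem eventually_infDist_ge (hD : IsClosed D) (hx : x ∈ D) {u : E k} (hu : ‖u‖ = 1) {d : ℝ}
    (hd : 0 < d) (hy : y = x + d • u) (hdy : Metric.infDist y D = d)
    (huniq : ∀ x' ∈ D, dist x' y = Metric.infDist y D → x' = x) {ε : ℝ} (hε : 0 < ε)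
    (hε1 : ε < 1) :
    ∀ᶠ h : ℝ in 𝓝[>] 0, d + h * (1 - ε) ≤ Metric.infDist (y + h • u) D := by
  obtain ⟨δ, hδ, hclose⟩ := exists_nearest_close hD huniq
    (show 0 < d * ε / 2 by positivity)
  have hev : ∀ᶠ h : ℝ in 𝓝[>] 0, h < min δ (d * ε) :=
    mem_nhdsWithin_of_mem_nhds (Iio_mem_nhds (lt_min hδ (by positivity)))
  filter_upwards [hev, self_mem_nhdsWithin] with h hh hpos
  have hpos' : (0 : ℝ) < h := hpos
  obtain ⟨z, hz, hzd⟩ := hD.exists_infDist_eq_dist ⟨x, hx⟩ (y + h • u)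
  have h1 : dist z x < d * ε / 2 := by
    refine hclose (y + h • u) ?_ z hz (by rw [hzd, dist_comm])
    rw [dist_eq_norm, add_sub_cancel_left, norm_smul, hu, mul_one, Real.norm_eq_abs,
      abs_of_pos hpos']
    exact hh.trans_le (min_le_left _ _)
  have h2 : h < d * ε := hh.trans_le (min_le_right _ _)
  rw [hzd, dist_eq_norm]
  have h3 : d ≤ ‖y - z‖ := by
    rw [← hdy, ← dist_eq_norm]; exact Metric.infDist_le_dist_of_mem hz
  have h4 : ‖y + h • u - z‖ ^ 2 = ‖y - z‖ ^ 2 + 2 * (h * inner ℝ (y - z) u) + h ^ 2 := by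
    rw [add_sub_right_comm, norm_add_sq_real, real_inner_smul_right, norm_smul, hu, mul_one,
      Real.norm_eq_abs, sq_abs]
  have h5 : d - d * ε / 2 ≤ inner ℝ (y - z) u := by
    have h6 : y - z = d • u - (z - x) := by rw [hy]; abel
    have h7 : inner ℝ (z - x) u ≤ ‖z - x‖ := by simpa [hu] using real_inner_le_norm (z - x) u
    rw [h6, inner_sub_left, real_inner_smul_left, real_inner_self_eq_norm_sq, hu]
    rw [dist_eq_norm] at h1
    linarith
  refine le_of_sq_le_sq ?_ (norm_nonneg _)
  rw [h4]
  have h8 : h * (d - d * ε / 2) ≤ h * inner ℝ (y - z) u := by gcongr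
  have h9 : d ^ 2 ≤ ‖y - z‖ ^ 2 := by gcongr
  have h10 : h * h ≤ h * (d * ε) := by gcongr
  nlinarith [mul_pos hpos' hpos', mul_pos hε (mul_pos hpos' hpos')]

/-- A segment issuing from a nearest point can be prolonged within the region of unique nearest
points. -/
theorem infDist_add_smul_of_unique (hD : IsClosed D) (hx : x ∈ D) {u : E k} (hu : ‖u‖ = 1) {d : ℝ}
    (hd : 0 < d) (hdy : Metric.infDist (x + d • u) D = d) {δ : ℝ} (hδ : 0 < δ)
    (huniq : HasUniqueProjection D (d + δ)) :
    Metric.infDist (x + (d + δ) • u) D = d + δ := by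
  set y := x + d • u with hy
  have hball : ∀ z ∈ Metric.closedBall y δ, Metric.infDist z D ≤ d + δ := by
    intro z hz
    have h2 : Metric.infDist z D ≤ Metric.infDist y D + dist z y :=
      Metric.infDist_le_infDist_add_dist
    rw [Metric.mem_closedBall] at hz
    linarith
  have hne : (Metric.closedBall y δ).Nonempty := ⟨y, Metric.mem_closedBall_self hδ.le⟩
  have hcont : Continuous fun z : E k => Metric.infDist z D := Metric.continuous_infDist_pt D
  have key : ∀ ε : ℝ, 0 < ε → ε < 1 → ∃ z ∈ Metric.closedBall y δ,
      d + (1 - ε) * δ ≤ Metric.infDist z D := by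
    intro ε hε hε1
    -- A maximum inside the ball is impossible: moving away from the nearest point of `z` raises the
    -- distance to `D` at rate at least `1 - ε / 2`, while the penalty grows at rate at most `1 -
    -- ε`. So `z` lies on the sphere of radius `δ`.
    obtain ⟨z, hz, hmax⟩ := (isCompact_closedBall y δ).exists_isMaxOn hne
      (f := fun z => Metric.infDist z D - (1 - ε) * dist z y)
      (hcont.sub (continuous_const.mul (continuous_id.dist continuous_const))).continuousOn
    have h0 : d ≤ Metric.infDist z D - (1 - ε) * dist z y := by
      have := hmax (Metric.mem_closedBall_self hδ.le)
      simpa [hdy] using this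
    refine ⟨z, hz, ?_⟩
    rcases (Metric.mem_closedBall.mp hz).lt_or_eq with hlt | heq
    · exfalso
      have hz0 : 0 < Metric.infDist z D := by
        have := mul_nonneg (sub_nonneg.mpr hε1.le) (dist_nonneg (x := z) (y := y))
        linarith
      obtain ⟨q, ⟨hqD, hqd⟩, hq⟩ := huniq z (hball z hz)
      set e := Metric.infDist z D with he
      have hnorm : ‖z - q‖ = e := by rw [← dist_eq_norm, dist_comm, hqd]
      have hw : ‖e⁻¹ • (z - q)‖ = 1 := by
        rw [norm_smul, hnorm, norm_inv, Real.norm_eq_abs, abs_of_pos hz0, inv_mul_cancel₀ hz0.ne']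
      have hev := eventually_infDist_ge hD hqD hw hz0
        (y := z) (by rw [smul_smul, mul_inv_cancel₀ hz0.ne', one_smul]; abel) he.symm
        (fun x' hx' h => hq x' ⟨hx', h⟩) (half_pos hε) (by linarith)
      have hev2 : ∀ᶠ h : ℝ in 𝓝[>] 0, h < δ - dist z y :=
        mem_nhdsWithin_of_mem_nhds (Iio_mem_nhds (by linarith))
      obtain ⟨h, h1, h2, h3⟩ := (hev.and (hev2.and self_mem_nhdsWithin)).exists
      have h3' : (0 : ℝ) < h := h3
      have h4 : dist (z + h • (e⁻¹ • (z - q))) y ≤ dist z y + h := by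
        have h5 : dist (z + h • (e⁻¹ • (z - q))) z = h := by
          rw [dist_eq_norm, add_sub_cancel_left, norm_smul, hw, mul_one, Real.norm_eq_abs,
            abs_of_pos h3']
        linarith [dist_triangle (z + h • (e⁻¹ • (z - q))) z y]
      have h6 := hmax (show z + h • (e⁻¹ • (z - q)) ∈ Metric.closedBall y δ by
        rw [Metric.mem_closedBall]; linarith)
      simp only [mem_ofPred_eq] at h6
      have h7 : (1 - ε) * dist (z + h • (e⁻¹ • (z - q))) y ≤ (1 - ε) * (dist z y + h) :=
        mul_le_mul_of_nonneg_left h4 (by linarith)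
      nlinarith [mul_pos h3' hε]
    · rw [heq] at h0
      linarith
  obtain ⟨z, hz, hmax⟩ := (isCompact_closedBall y δ).exists_isMaxOn hne hcont.continuousOn
  have hzd : d + δ ≤ Metric.infDist z D := by
    have h1 : ∀ᶠ ε : ℝ in 𝓝[>] 0, d + (1 - ε) * δ ≤ Metric.infDist z D := by
      have : ∀ᶠ ε : ℝ in 𝓝[>] 0, ε < 1 := mem_nhdsWithin_of_mem_nhds (Iio_mem_nhds one_pos)
      filter_upwards [this, self_mem_nhdsWithin] with ε hε1 hε
      obtain ⟨w, hw, hle⟩ := key ε hε hε1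
      exact hle.trans (hmax hw)
    have h2 : Tendsto (fun ε : ℝ => d + (1 - ε) * δ) (𝓝[>] 0) (𝓝 (d + (1 - 0) * δ)) :=
      (Continuous.tendsto (by fun_prop) 0).mono_left nhdsWithin_le_nhds
    have := le_of_tendsto h2 h1
    simpa using this
  have hzx : Metric.infDist z D ≤ ‖z - x‖ := by
    rw [← dist_eq_norm]; exact Metric.infDist_le_dist_of_mem hx
  have hzy : ‖z - y‖ ≤ δ := by rw [← dist_eq_norm]; exact hz
  have hyx : y - x = d • u := by rw [hy]; abel
  have hyxn : ‖y - x‖ = d := by rw [hyx, norm_smul, hu, mul_one, Real.norm_eq_abs, abs_of_pos hd]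
  have htri : ‖(z - y) + (y - x)‖ ≤ ‖z - y‖ + ‖y - x‖ := norm_add_le _ _
  have hsum : (z - y) + (y - x) = z - x := by abel
  have hzy' : ‖z - y‖ = δ := by rw [hsum] at htri; linarith
  -- Equality in the triangle inequality forces the maximizer onto the ray from `x` through `y`.
  have hray : SameRay ℝ (z - y) (y - x) := by
    rw [sameRay_iff_norm_add]
    rw [hsum] at htri ⊢
    linarith
  have h3 := hray.norm_smul_eq
  rw [hzy', hyxn, hyx, smul_comm] at h3
  have h4 : δ • u = z - y := smul_right_injective _ hd.ne' h3
  have h5 : x + (d + δ) • u = z := by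
    rw [add_smul, h4, hy]; abel
  rw [h5]
  refine le_antisymm (hball z hz) hzd

theorem mem_frontier_of_nearest (hx : x ∈ D) (hy : y ∉ D) (h : dist x y = Metric.infDist y D) :
    x ∈ frontier D := by
  refine ⟨subset_closure hx, fun hint => ?_⟩
  have hxy : 0 < dist x y := dist_pos.mpr fun h => hy (h ▸ hx)
  have hc : Tendsto (fun t : ℝ => x + t • (y - x)) (𝓝[>] 0) (𝓝 x) := by
    have : Tendsto (fun t : ℝ => x + t • (y - x)) (𝓝 0) (𝓝 (x + (0 : ℝ) • (y - x))) :=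
      Continuous.tendsto (by fun_prop) 0
    simpa using this.mono_left nhdsWithin_le_nhds
  have h1 : ∀ᶠ t : ℝ in 𝓝[>] 0, t < 1 := mem_nhdsWithin_of_mem_nhds (Iio_mem_nhds one_pos)
  obtain ⟨t, h1, h2, h3⟩ := (h1.and ((hc.eventually (mem_interior_iff_mem_nhds.mp hint)).and
    self_mem_nhdsWithin)).exists
  have h3' : (0 : ℝ) < t := h3
  have h4 := Metric.infDist_le_dist_of_mem (x := y) h2
  have h5 : dist y (x + t • (y - x)) = (1 - t) * dist x y := by
    have : y - (x + t • (y - x)) = (1 - t) • (y - x) := by rw [sub_smul, one_smul]; abel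
    rw [dist_eq_norm, this, norm_smul, Real.norm_eq_abs, abs_of_pos (by linarith), dist_comm x y,
      dist_eq_norm]
  rw [h5, ← h] at h4
  nlinarith

theorem IsC2Domain.exists_nearest (hD : IsC2Domain D) (hy : y ∉ D) :
    ∃ x ∈ frontier D, 0 < Metric.infDist y D ∧ dist x y = Metric.infDist y D ∧
      y = x + Metric.infDist y D • outwardNormal D x := by
  have hne : D.Nonempty := hD.nonempty_interior.mono interior_subset
  obtain ⟨x, hx, hxd⟩ := hD.isClosed.exists_infDist_eq_dist hne y
  rw [dist_comm] at hxd
  have hxf := mem_frontier_of_nearest hx hy hxd.symm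
  have h1 := hD.sub_eq_smul_outwardNormal (y := y) hxf fun z hz => by
    rw [← dist_eq_norm, ← dist_eq_norm, dist_comm, ← hxd]
    exact Metric.infDist_le_dist_of_mem hz
  refine ⟨x, hxf, (hD.isClosed.notMem_iff_infDist_pos hne).mp hy, hxd.symm, ?_⟩
  rw [hxd, dist_comm, dist_eq_norm, ← h1]
  abel

/-- Below the critical radius, the distance to `D` grows at unit rate along the normals. -/
theorem IsC2Domain.infDist_add_smul_outwardNormal (hD : IsC2Domain D) (hp : p ∈ frontier D)
    (ht : 0 < t) (htc : ENNReal.ofReal t < criticalRadius D) :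
    Metric.infDist (p + t • outwardNormal D p) D = t := by
  have huniq := hasUniqueProjection_of_lt htc
  -- `A` is dense at `p`: points outside `D` near `p` have nearest points near `p`, and the segments
  -- from these can be prolonged to length `t`. Continuity of `ν` then carries the equality to `p`.
  let A : Set (E k) := {x ∈ frontier D | Metric.infDist (x + t • outwardNormal D x) D = t}
  have hA : p ∈ closure A := by
    rw [Metric.mem_closure_iff]
    intro ε hε
    have h1 : p ∈ closure Dᶜ := by rw [closure_compl]; exact hp.2
    obtain ⟨y, hy, hpy⟩ := Metric.mem_closure_iff.mp h1 (min (ε / 2) t) (by positivity)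
    obtain ⟨x, hx, hd0, hxy, hyx⟩ := hD.exists_nearest hy
    have hpD : p ∈ D := hD.isClosed.frontier_subset hp
    have h2 : Metric.infDist y D ≤ dist p y := by
      rw [dist_comm]; exact Metric.infDist_le_dist_of_mem hpD
    refine ⟨x, ⟨hx, ?_⟩, ?_⟩
    · have h3 : 0 < t - Metric.infDist y D := by linarith [min_le_right (ε / 2) t]
      have h4 := infDist_add_smul_of_unique hD.isClosed (hD.isClosed.frontier_subset hx)
        (hD.norm_outwardNormal hx) hd0 (by rw [← hyx]) h3 (by rwa [add_sub_cancel])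
      rwa [add_sub_cancel] at h4
    · linarith [dist_triangle_right p x y, min_le_left (ε / 2) t]
  have hc : ContinuousWithinAt (fun x => Metric.infDist (x + t • outwardNormal D x) D) A p := by
    have h1 : ContinuousWithinAt (outwardNormal D) A p :=
      (hD.continuousOn_outwardNormal p hp).mono fun x hx => hx.1
    exact (Metric.continuous_infDist_pt D).continuousAt.comp_continuousWithinAt
      (continuousWithinAt_id.add (h1.const_smul t))
  have h2 := hc.mem_closure_image hA
  have h3 : closure ((fun x => Metric.infDist (x + t • outwardNormal D x) D) '' A) ⊆ {t} :=
    closure_minimal (by rintro _ ⟨x, hx, rfl⟩; exact hx.2) isClosed_singleton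
  exact h3 h2

/-- The normal exponential map `(x, t) ↦ x + t ν(x)`. -/
noncomputable def normalExp (D : Set (E k)) (z : E k × ℝ) : E k := z.1 + z.2 • outwardNormal D z.1

/-- The image point determines `t` as its distance to `D` and `x` as its unique nearest point. -/
theorem IsC2Domain.injOn_normalExp (hD : IsC2Domain D) (hrc : ENNReal.ofReal r < criticalRadius D) :
    InjOn (normalExp D) (frontier D ×ˢ Ioc 0 r) := by
  have key : ∀ z ∈ frontier D ×ˢ Ioc 0 r, Metric.infDist (normalExp D z) D = z.2 ∧
      dist z.1 (normalExp D z) = Metric.infDist (normalExp D z) D := by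
    rintro ⟨x, t⟩ ⟨hx, ht⟩
    have h1 := hD.infDist_add_smul_outwardNormal hx ht.1
      ((ENNReal.ofReal_le_ofReal ht.2).trans_lt hrc)
    refine ⟨h1, ?_⟩
    rw [normalExp, h1, dist_eq_norm, sub_add_cancel_left, norm_neg, norm_smul,
      hD.norm_outwardNormal hx, mul_one, Real.norm_eq_abs, abs_of_pos ht.1]
  intro z hz w hw h
  obtain ⟨h1, h2⟩ := key z hz
  obtain ⟨h3, h4⟩ := key w hw
  rw [← h] at h3 h4
  have huniq := hasUniqueProjection_of_lt hrc (normalExp D z) (by rw [h1]; exact hz.2.2)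
  exact Prod.ext (huniq.unique ⟨hD.isClosed.frontier_subset hz.1, h2⟩
    ⟨hD.isClosed.frontier_subset hw.1, h4⟩) (h1.symm.trans h3)

theorem IsC2Domain.image_normalExp (hD : IsC2Domain D)
    (hrc : ENNReal.ofReal r < criticalRadius D) :
    normalExp D '' (frontier D ×ˢ Ioc 0 r) = tube D r \ D := by
  have hne : D.Nonempty := hD.nonempty_interior.mono interior_subset
  ext y
  constructor
  · rintro ⟨⟨x, t⟩, ⟨hx, ht⟩, rfl⟩
    have h1 : Metric.infDist (normalExp D (x, t)) D = t :=
      hD.infDist_add_smul_outwardNormal hx ht.1 ((ENNReal.ofReal_le_ofReal ht.2).trans_lt hrc)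
    refine ⟨h1.trans_le ht.2, ?_⟩
    rw [hD.isClosed.notMem_iff_infDist_pos hne, h1]
    exact ht.1
  · rintro ⟨hy, hyD⟩
    obtain ⟨x, hx, hd0, -, hyx⟩ := hD.exists_nearest hyD
    exact ⟨(x, Metric.infDist y D), ⟨hx, hd0, hy⟩, hyx.symm⟩

/-- The open ball of radius `s` centred at `p + s ν(p)` misses `D`; expanding the square of the
distance from `x` to its centre gives the inequality. -/
theorem IsC2Domain.inner_sub_outwardNormal_le (hD : IsC2Domain D) (hp : p ∈ frontier D)
    (hs : 0 < s) (hsc : ENNReal.ofReal s < criticalRadius D) (hx : x ∈ D) :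
    2 * s * inner ℝ (x - p) (outwardNormal D p) ≤ ‖x - p‖ ^ 2 := by
  have h1 := hD.infDist_add_smul_outwardNormal hp hs hsc
  have h2 : s ≤ ‖(p + s • outwardNormal D p) - x‖ := by
    rw [← dist_eq_norm]; exact h1.symm.trans_le (Metric.infDist_le_dist_of_mem hx)
  have h3 : (p + s • outwardNormal D p) - x = s • outwardNormal D p - (x - p) := by abel
  have h4 : s ^ 2 ≤ ‖(p + s • outwardNormal D p) - x‖ ^ 2 := by gcongr
  rw [h3, norm_sub_sq_real, real_inner_smul_left, norm_smul, hD.norm_outwardNormal hp,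
    Real.norm_eq_abs, mul_one, sq_abs, real_inner_comm] at h4
  linarith

end TubeExpansion

namespace TubeExpansion

/-! ### The Jacobian of the normal exponential map -/

theorem _root_.LinearMap.det_one_add_comp_comm {V W : Type*} [AddCommGroup V] [Module ℝ V]
    [FiniteDimensional ℝ V] [AddCommGroup W] [Module ℝ W] [FiniteDimensional ℝ W]
    (A : W →ₗ[ℝ] V) (B : V →ₗ[ℝ] W) :
    LinearMap.det (1 + A ∘ₗ B) = LinearMap.det (1 + B ∘ₗ A) := by
  let b := Module.finBasis ℝ V
  let c := Module.finBasis ℝ W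
  rw [← LinearMap.det_toMatrix b, ← LinearMap.det_toMatrix c, map_add, map_add,
    LinearMap.toMatrix_one, LinearMap.toMatrix_one, LinearMap.toMatrix_comp b c b,
    LinearMap.toMatrix_comp c b c, Matrix.det_one_add_mul_comm]

variable {k : ℕ} {D : Set (E k)} {p x y : E k} {r s t : ℝ} {N : E k → E k}

theorem mem_tangentSpace {v : E k} :
    v ∈ tangentSpace D p ↔ inner ℝ (outwardNormal D p) v = 0 := by
  rw [tangentSpace, Submodule.mem_orthogonal_singleton_iff_inner_right]

theorem IsC2Domain.coe_orthogonalProjectionOnto_tangentSpace (hD : IsC2Domain D)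
    (hp : p ∈ frontier D) (v : E k) :
    ((tangentSpace D p).orthogonalProjectionOnto v : E k) = perp (outwardNormal D p) v := by
  rw [← Submodule.starProjection_apply, tangentSpace, Submodule.starProjection_orthogonal_val,
    Submodule.starProjection_unit_singleton ℝ (hD.norm_outwardNormal hp), perp_apply]

/-- Derivatives within a hypersurface are not unique on the ambient space, but on tangent vectors
they are: both sides are the velocity of `ν` along the same boundary curve. -/
theorem IsC2Domain.fderivWithin_outwardNormal (hD : IsC2Domain D) (hp : p ∈ frontier D)
    (hN : DifferentiableAt ℝ N p) (heq : ∀ᶠ x in 𝓝 p, x ∈ frontier D → outwardNormal D x = N x)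
    {v : E k} (hv : inner ℝ (outwardNormal D p) v = 0) :
    fderivWithin ℝ (outwardNormal D) (frontier D) p v = fderiv ℝ N p v := by
  have heq' : outwardNormal D =ᶠ[𝓝[frontier D] p] N := by
    filter_upwards [mem_nhdsWithin_of_mem_nhds heq, self_mem_nhdsWithin] with x hx hx' using hx hx'
  have hd : DifferentiableWithinAt ℝ (outwardNormal D) (frontier D) p :=
    hN.differentiableWithinAt.congr_of_eventuallyEq heq' (heq.self_of_nhds hp)
  obtain ⟨c, hc0, hc, hcD⟩ := hD.exists_curve hp hv
  have hcp : Tendsto c (𝓝 0) (𝓝 p) := by simpa [hc0] using hc.continuousAt.tendsto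
  have h1 : HasDerivAt (outwardNormal D ∘ c)
      (fderivWithin ℝ (outwardNormal D) (frontier D) p v) 0 := by
    have h := hd.hasFDerivWithinAt
    rw [← hc0] at h
    have h2 := h.comp_hasDerivWithinAt (s := {τ | c τ ∈ frontier D}) (0 : ℝ) hc.hasDerivWithinAt
      (fun τ hτ => hτ)
    rw [hc0] at h2
    exact h2.hasDerivAt hcD
  have h2 : HasDerivAt (N ∘ c) (fderiv ℝ N p v) 0 := by
    have h := hN.hasFDerivAt
    rw [← hc0] at h
    have h3 := h.comp_hasDerivAt (0 : ℝ) hc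
    rwa [hc0] at h3
  refine h1.unique (h2.congr_of_eventuallyEq ?_)
  filter_upwards [hcD, hcp.eventually heq] with τ h3 h4 using h4 h3

/-- The Jacobian determinant of the normal exponential map. -/
noncomputable def tubeJacobian (D : Set (E k)) (z : E k × ℝ) : ℝ :=
  LinearMap.det (1 + z.2 • shapeOperator D z.1)

/-- The identity `det (1 + AB) = det (1 + BA)` moves the determinant from the tangent space, which
varies with `p`, to the fixed ambient space. Continuity and comparison with an ambient derivative
then make sense. -/
theorem IsC2Domain.tubeJacobian_eq (hD : IsC2Domain D) (hp : p ∈ frontier D)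
    (hN : DifferentiableAt ℝ N p) (heq : ∀ᶠ x in 𝓝 p, x ∈ frontier D → outwardNormal D x = N x) :
    tubeJacobian D (p, t) = (ContinuousLinearMap.id ℝ (E k) + t • (fderiv ℝ N p ∘L perp (N p))).det := by
  let A : E k →ₗ[ℝ] tangentSpace D p := (tangentSpace D p).orthogonalProjectionOnto.toLinearMap
  let B : tangentSpace D p →ₗ[ℝ] E k := t • ((fderiv ℝ N p).toLinearMap ∘ₗ (tangentSpace D p).subtype)
  have h1 : t • shapeOperator D p = A ∘ₗ B := by
    ext v
    have hv := mem_tangentSpace.mp v.2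
    simp [A, B, shapeOperator, hD.fderivWithin_outwardNormal hp hN heq hv]
  have h2 : (1 : E k →ₗ[ℝ] E k) + B ∘ₗ A =
      (ContinuousLinearMap.id ℝ (E k) + t • (fderiv ℝ N p ∘L perp (N p))).toLinearMap := by
    ext1 v
    change v + t • fderiv ℝ N p ((tangentSpace D p).orthogonalProjectionOnto v : E k)
      = v + t • fderiv ℝ N p (perp (N p) v)
    rw [hD.coe_orthogonalProjectionOnto_tangentSpace hp, ← heq.self_of_nhds hp]
  rw [tubeJacobian, h1, LinearMap.det_one_add_comp_comm, h2, ContinuousLinearMap.det]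

theorem IsC2Domain.continuousOn_tubeJacobian (hD : IsC2Domain D) :
    ContinuousOn (tubeJacobian D) (frontier D ×ˢ univ) := by
  rintro ⟨p, t⟩ ⟨hp, -⟩
  obtain ⟨N, hN, heq⟩ := hD.exists_normal_extension hp
  have hc : ContinuousAt (fun z : E k × ℝ =>
      (ContinuousLinearMap.id ℝ (E k) + z.2 • (fderiv ℝ N z.1 ∘L perp (N z.1))).det) (p, t) := by
    have h1 : ContinuousAt (fderiv ℝ N) p :=
      (hN.fderiv_right (m := 0) (by norm_num)).continuousAt
    have h1' : ContinuousAt (fun z : E k × ℝ => fderiv ℝ N z.1) (p, t) :=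
      ContinuousAt.comp (f := Prod.fst) (x := (p, t)) h1 continuousAt_fst
    have h2 : ContinuousAt (fun z : E k × ℝ => N z.1) (p, t) :=
      ContinuousAt.comp (f := Prod.fst) (x := (p, t)) hN.continuousAt continuousAt_fst
    have h3 : Continuous (perp : E k → E k →L[ℝ] E k) := by
      refine continuous_clm_apply.mpr fun v => ?_
      simp only [perp_apply]
      fun_prop
    exact ContinuousLinearMap.continuous_det.continuousAt.comp
      (continuousAt_const.add (continuousAt_snd.smul (h1'.clm_comp (h3.continuousAt.comp h2))))
  refine hc.continuousWithinAt.congr_of_eventuallyEq ?_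
    (hD.tubeJacobian_eq hp (hN.differentiableAt (by norm_num)) heq)
  have h4 : ∀ᶠ x in 𝓝 p, ContDiffAt ℝ 1 N x ∧
      ∀ᶠ x' in 𝓝 x, x' ∈ frontier D → outwardNormal D x' = N x' :=
    (hN.eventually (by simp)).and heq.eventually_nhds
  have h5 : ∀ᶠ z : E k × ℝ in 𝓝 (p, t), ContDiffAt ℝ 1 N z.1 ∧
      ∀ᶠ x' in 𝓝 z.1, x' ∈ frontier D → outwardNormal D x' = N x' :=
    (continuous_fst.tendsto (p, t)).eventually h4
  filter_upwards [mem_nhdsWithin_of_mem_nhds h5, self_mem_nhdsWithin] with z hz hz'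
  exact hD.tubeJacobian_eq hz'.1 (hz.1.differentiableAt (by norm_num)) hz.2

/-- The principal curvatures are at least `-1 / s`. The exterior ball inequalities at `p` and at a
nearby boundary point `c τ` add up to `-‖c τ - p‖² ≤ s ⟨c τ - p, ν(c τ) - ν(p)⟩`; divide by `τ²` and
let `τ → 0`. -/
theorem IsC2Domain.inner_shapeOperator_ge (hD : IsC2Domain D) (hp : p ∈ frontier D)
    (hs : 0 < s) (hsc : ENNReal.ofReal s < criticalRadius D) (v : tangentSpace D p) :
    -‖v‖ ^ 2 ≤ s * inner ℝ v (shapeOperator D p v) := by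
  obtain ⟨N, hN, heq⟩ := hD.exists_normal_extension hp
  have hv := mem_tangentSpace.mp v.2
  have hNd : DifferentiableAt ℝ N p := hN.differentiableAt (by norm_num)
  have h1 : inner ℝ v (shapeOperator D p v) = inner ℝ (v : E k) (fderiv ℝ N p v) := by
    have h2 : ((shapeOperator D p v : tangentSpace D p) : E k)
        = perp (outwardNormal D p) (fderiv ℝ N p v) := by
      rw [← hD.coe_orthogonalProjectionOnto_tangentSpace hp,
        ← hD.fderivWithin_outwardNormal hp hNd heq hv]
      rfl
    rw [Submodule.coe_inner, h2, perp_apply, inner_sub_right, real_inner_smul_right,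
      real_inner_comm (outwardNormal D p) (v : E k), hv, mul_zero, sub_zero]
  obtain ⟨c, hc0, hc, hcD⟩ := hD.exists_curve hp hv
  have hcp : Tendsto c (𝓝 0) (𝓝 p) := by simpa [hc0] using hc.continuousAt.tendsto
  have h2 : HasDerivAt (N ∘ c) (fderiv ℝ N p v) 0 := by
    have h := hNd.hasFDerivAt
    rw [← hc0] at h
    have h3 := h.comp_hasDerivAt (0 : ℝ) hc
    rwa [hc0] at h3
  have hs1 := hc.tendsto_slope_zero_right
  have hs2 := h2.tendsto_slope_zero_right
  simp only [zero_add, Function.comp, hc0] at hs1 hs2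
  have hlim := ((hs1.norm.pow 2).neg)
  have hlim2 := (hs1.inner (𝕜 := ℝ) hs2).const_mul s
  rw [h1]
  refine le_of_tendsto_of_tendsto hlim hlim2 ?_
  have h4 := (hcD.and (hcp.eventually heq)).filter_mono (nhdsWithin_le_nhds (s := Ioi 0))
  filter_upwards [h4] with τ ⟨h5, h6⟩
  rw [← h6 h5, ← heq.self_of_nhds hp]
  have h7 := hD.inner_sub_outwardNormal_le hp hs hsc (hD.isClosed.frontier_subset h5)
  have h8 := hD.inner_sub_outwardNormal_le h5 hs hsc (hD.isClosed.frontier_subset hp)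
  rw [norm_smul, mul_pow, real_inner_smul_left, real_inner_smul_right, Real.norm_eq_abs, sq_abs,
    inner_sub_right]
  rw [← neg_sub (c τ) p, inner_neg_left, norm_neg] at h8
  have h9 : 0 ≤ τ⁻¹ ^ 2 := sq_nonneg _
  nlinarith

/-- The determinant is `1` at `0`, so a negative value at `t` forces a zero at some `τ < t`. A
kernel vector there is a principal direction of curvature `-1 / τ < -1 / t`, against the lower
curvature bound. -/
theorem IsC2Domain.tubeJacobian_nonneg (hD : IsC2Domain D) (hp : p ∈ frontier D) (ht : 0 < t)
    (htc : ENNReal.ofReal t < criticalRadius D) : 0 ≤ tubeJacobian D (p, t) := by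
  by_contra! hneg
  have hcont : ContinuousOn (fun τ => tubeJacobian D (p, τ)) (Icc 0 t) := by
    refine hD.continuousOn_tubeJacobian.comp (by fun_prop) fun τ _ => ⟨hp, mem_univ _⟩
  have h0 : tubeJacobian D (p, 0) = 1 := by simp [tubeJacobian]
  obtain ⟨τ, hτ, hτ0⟩ := intermediate_value_Icc' ht.le hcont
    (show (0 : ℝ) ∈ Icc _ _ by rw [h0]; exact ⟨hneg.le, zero_le_one⟩)
  have hτpos : 0 < τ := by
    refine lt_of_le_of_ne hτ.1 fun h => ?_
    simp only [← h, h0] at hτ0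
    exact one_ne_zero hτ0
  have hτt : τ < t := by
    refine lt_of_le_of_ne hτ.2 fun h => ?_
    simp only [h] at hτ0
    exact hneg.ne hτ0
  have hker := LinearMap.bot_lt_ker_of_det_eq_zero hτ0
  obtain ⟨v, hv, hv0⟩ := (Submodule.ne_bot_iff _).mp hker.ne'
  have hv1 : v + τ • shapeOperator D p v = 0 := by simpa using hv
  have h2 := hD.inner_shapeOperator_ge hp ht htc v
  have h3 : ‖v‖ ^ 2 + τ * inner ℝ v (shapeOperator D p v) = 0 := by
    rw [← real_inner_self_eq_norm_sq, ← real_inner_smul_right, ← inner_add_right, hv1,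
      inner_zero_right]
  have h4 : 0 < ‖v‖ := norm_pos_iff.mpr hv0
  have h5 : 0 < ‖v‖ ^ 2 := by positivity
  nlinarith

end TubeExpansion

/-! ### Local comparison of measures -/

theorem MeasureTheory.Measure.le_of_forall_nhds {X : Type*} [TopologicalSpace X]
    [SecondCountableTopology X] [MeasurableSpace X] [BorelSpace X] {μ ν : Measure X}
    (h : ∀ x, ∃ U ∈ 𝓝 x, ∀ A ⊆ U, MeasurableSet A → μ A ≤ ν A) : μ ≤ ν := by
  choose U hU hle using h
  obtain ⟨s, hs, hcov⟩ := TopologicalSpace.countable_cover_nhds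
    (f := fun x => interior (U x)) fun x => interior_mem_nhds.mpr (hU x)
  rcases isEmpty_or_nonempty X with hX | hX
  · rw [Measure.eq_zero_of_isEmpty μ, Measure.eq_zero_of_isEmpty ν]
  have hne : s.Nonempty := by
    by_contra hs'
    rw [not_nonempty_iff_eq_empty.mp hs'] at hcov
    simpa using eq_univ_iff_forall.mp hcov (Classical.arbitrary X)
  obtain ⟨e, rfl⟩ := hs.exists_eq_range hne
  let V : ℕ → Set X := fun n => interior (U (e n))
  have hV : ∀ n, MeasurableSet (V n) := fun n => isOpen_interior.measurableSet
  have hVU : ⋃ n, disjointed V n = univ := by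
    rw [iUnion_disjointed, ← hcov, biUnion_range]
  refine Measure.le_iff.mpr fun A hA => ?_
  have hdec : A = ⋃ n, A ∩ disjointed V n := by rw [← inter_iUnion, hVU, inter_univ]
  have hdis : Pairwise (Function.onFun Disjoint fun n => A ∩ disjointed V n) := fun i j hij =>
    (disjoint_disjointed V hij).mono inter_subset_right inter_subset_right
  have hmeas : ∀ n, MeasurableSet (A ∩ disjointed V n) := fun n =>
    hA.inter (MeasurableSet.disjointed hV n)
  rw [hdec, measure_iUnion hdis hmeas, measure_iUnion hdis hmeas]
  exact ENNReal.tsum_le_tsum fun n => hle (e n) _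
    (inter_subset_right.trans ((disjointed_subset V n).trans interior_subset)) (hmeas n)

/-- A measure which locally is almost proportional to `μ`, with a factor given by a continuous
function, has this function as its density. -/
theorem MeasureTheory.Measure.eq_withDensity_of_forall_nhds {X : Type*} [TopologicalSpace X]
    [SecondCountableTopology X] [MeasurableSpace X] [BorelSpace X] {μ ν : Measure X}
    [IsLocallyFiniteMeasure μ] {ρ : X → ℝ≥0} (hρ : Continuous ρ)
    (h : ∀ x, ∀ ε : ℝ≥0, 0 < ε → ∃ U ∈ 𝓝 x, ∀ A ⊆ U, MeasurableSet A →
      ν A ≤ (ρ x + ε) * μ A ∧ ρ x * μ A ≤ ν A + ε * μ A) :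
    ν = μ.withDensity fun x => ρ x := by
  have hm : Measurable fun x => (ρ x : ℝ≥0∞) := hρ.measurable.coe_nnreal_ennreal
  have hclose : ∀ x, ∀ ε : ℝ≥0, 0 < ε → ∃ U ∈ 𝓝 x, ∀ y ∈ U, ρ x ≤ ρ y + ε ∧ ρ y ≤ ρ x + ε := by
    intro x ε hε
    refine ⟨_, (hρ.tendsto x).eventually (Metric.ball_mem_nhds (ρ x) hε), fun y hy => ?_⟩
    have hy' : |(ρ y : ℝ) - ρ x| < ε := by simpa [← NNReal.dist_eq] using hy
    rw [abs_lt] at hy'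
    constructor <;> rw [← NNReal.coe_le_coe] <;> push_cast <;> linarith
  have hlocal : ∀ x, ∃ U ∈ 𝓝 x, μ U ≠ ∞ := fun x =>
    (μ.finiteAt_nhds x).imp fun U hU => ⟨hU.1, hU.2.ne⟩
  -- Where `μ` is finite the error term `2 ε μ(A)` disappears in the limit. One `ε` comes from the
  -- hypothesis, the other from the oscillation of `ρ`.
  have limit : ∀ {a b c : ℝ≥0∞}, c ≠ ∞ → (∀ ε : ℝ≥0, 0 < ε → a ≤ b + 2 * ε * c) → a ≤ b := by
    intro a b c hc h
    refine ENNReal.le_of_forall_pos_le_add fun η hη _ => ?_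
    lift c to ℝ≥0 using hc
    refine (h (η / (2 * (c + 1))) (by positivity)).trans ?_
    gcongr
    norm_cast
    rw [← NNReal.coe_le_coe]
    push_cast
    rw [mul_div, div_mul_eq_mul_div, div_le_iff₀ (by positivity)]
    nlinarith [η.coe_nonneg, c.coe_nonneg]
  have h1 : ∀ ε : ℝ≥0, 0 < ε → ν ≤ μ.withDensity (fun x => ρ x) + (2 * ε) • μ := by
    intro ε hε
    refine Measure.le_of_forall_nhds fun x => ?_
    obtain ⟨U, hU, hUA⟩ := h x ε hε
    obtain ⟨V, hV, hVy⟩ := hclose x ε hε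
    refine ⟨U ∩ V, inter_mem hU hV, fun A hA hAm => ?_⟩
    rw [Measure.add_apply, withDensity_apply _ hAm, Measure.smul_apply, ENNReal.smul_def, smul_eq_mul]
    have h2 : (ρ x : ℝ≥0∞) * μ A ≤ (∫⁻ a in A, ρ a ∂μ) + ε * μ A := by
      rw [← setLIntegral_const, ← setLIntegral_const, ← lintegral_add_left hm]
      exact setLIntegral_mono (hm.add measurable_const) fun y hy => by
        exact_mod_cast (hVy y (hA hy).2).1
    calc ν A ≤ (ρ x + ε) * μ A := (hUA A (fun a ha => (hA ha).1) hAm).1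
      _ = ρ x * μ A + ε * μ A := add_mul _ _ _
      _ ≤ ((∫⁻ a in A, ρ a ∂μ) + ε * μ A) + ε * μ A := by gcongr
      _ = _ := by rw [ENNReal.coe_mul, add_assoc, ← add_mul, ENNReal.coe_ofNat, two_mul]
  have h2 : ∀ ε : ℝ≥0, 0 < ε → μ.withDensity (fun x => ρ x) ≤ ν + (2 * ε) • μ := by
    intro ε hε
    refine Measure.le_of_forall_nhds fun x => ?_
    obtain ⟨U, hU, hUA⟩ := h x ε hε
    obtain ⟨V, hV, hVy⟩ := hclose x ε hε
    refine ⟨U ∩ V, inter_mem hU hV, fun A hA hAm => ?_⟩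
    rw [Measure.add_apply, withDensity_apply _ hAm, Measure.smul_apply, ENNReal.smul_def, smul_eq_mul]
    calc ∫⁻ a in A, ρ a ∂μ ≤ ∫⁻ _ in A, (ρ x + ε) ∂μ :=
          setLIntegral_mono measurable_const fun y hy => by exact_mod_cast (hVy y (hA hy).2).2
      _ = ρ x * μ A + ε * μ A := by rw [setLIntegral_const, add_mul]
      _ ≤ (ν A + ε * μ A) + ε * μ A := by
        gcongr
        exact (hUA A (fun a ha => (hA ha).1) hAm).2
      _ = _ := by rw [ENNReal.coe_mul, add_assoc, ← add_mul, ENNReal.coe_ofNat, two_mul]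
  refine le_antisymm (Measure.le_of_forall_nhds fun x => ?_) (Measure.le_of_forall_nhds fun x => ?_)
  all_goals
    obtain ⟨U, hU, hfin⟩ := hlocal x
    refine ⟨U, hU, fun A hA hAm => limit (measure_ne_top_of_subset hA hfin) fun ε hε => ?_⟩
  · simpa [ENNReal.smul_def] using h1 ε hε A
  · simpa [ENNReal.smul_def] using h2 ε hε A

theorem LipschitzOnWith.euclideanHausdorffMeasure_image_le {X Y : Type*} [MetricSpace X]
    [MeasurableSpace X] [BorelSpace X] [MetricSpace Y] [MeasurableSpace Y] [BorelSpace Y]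
    {K : ℝ≥0} {f : X → Y} {s : Set X} (h : LipschitzOnWith K f s) (d : ℕ) :
    μHE[d] (f '' s) ≤ (K : ℝ≥0∞) ^ d * μHE[d] s := by
  have h1 := h.hausdorffMeasure_image_le (d := d) (Nat.cast_nonneg d)
  rw [ENNReal.rpow_natCast] at h1
  rw [Measure.euclideanHausdorffMeasure_def, Measure.euclideanHausdorffMeasure_def,
    Measure.smul_apply, Measure.smul_apply, ENNReal.smul_def, ENNReal.smul_def, smul_eq_mul,
    smul_eq_mul, mul_left_comm]
  gcongr

/-! ### Slicing by parallel hyperplanes, and local finiteness of surface measure. -/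

namespace TubeExpansion

variable {k : ℕ} {D : Set (E k)} {p x y : E k} {r s t : ℝ}

/-- The map `(x, t) ↦ x - ⟨n, x⟩ n + t n` from `ℝ^k × ℝ` to `ℝ^k`. -/
noncomputable def perpAdd (n : E k) : E k × ℝ →L[ℝ] E k :=
  (perp n).coprod (ContinuousLinearMap.toSpanSingleton ℝ n)

@[simp] theorem perpAdd_apply (n : E k) (z : E k × ℝ) :
    perpAdd n z = perp n z.1 + z.2 • n := by
  simp [perpAdd]

theorem perp_perpAdd {n : E k} (hn : ‖n‖ = 1) (z : E k × ℝ) :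
    perp n (perpAdd n z) = perp n z.1 := by
  rw [perp_apply n (perpAdd n z), perpAdd_apply, inner_add_right, inner_perp hn,
    real_inner_smul_right, real_inner_self_eq_norm_sq, hn]
  simp

theorem inner_perpAdd {n : E k} (hn : ‖n‖ = 1) (z : E k × ℝ) :
    inner ℝ n (perpAdd n z) = z.2 := by
  rw [perpAdd_apply, inner_add_right, inner_perp hn, real_inner_smul_right,
    real_inner_self_eq_norm_sq, hn]
  simp

theorem volume_eq_lintegral_slices {n : E k} (hn : ‖n‖ = 1) {B : Set (E k)} (hB : MeasurableSet B) :
    volume B = ∫⁻ s : ℝ, μHE[k - 1] (B ∩ {z | inner ℝ n z = s}) := by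
  have hn0 : n ≠ 0 := by rintro rfl; simp at hn
  have h := EuclideanGeometry.euclideanHausdorffMeasure_eq_lintegral (P := E k) (0 : E k) hn0 hB
  rw [InnerProductSpace.euclideanHausdorffMeasure_eq_volume, finrank_euclideanSpace_fin] at h
  rw [h, ← ofReal_norm, hn, ENNReal.ofReal_one, one_mul]
  congr with s
  congr 2
  ext z
  simp only [SetLike.mem_coe, AffineSubspace.mem_mk', Submodule.mem_orthogonal_singleton_iff_inner_right,
    vsub_eq_sub, vadd_eq_add, add_zero, inner_sub_right, real_inner_smul_right,
    real_inner_self_eq_norm_sq, hn, mem_ofPred_eq]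
  constructor <;> intro h <;> linarith

/-- If the projection along `n` has an `L`-Lipschitz inverse on a set `M`, then it changes volumes
by a factor at most `L ^ (k - 1)`. -/
theorem lintegral_slices_le {n : E k} (hn : ‖n‖ = 1) {M W : Set (E k)} {Ψ : E k → E k} {L : ℝ≥0}
    (hL : LipschitzOnWith L Ψ W) (hMW : ∀ x ∈ M, perp n x ∈ W ∧ Ψ (perp n x) = x)
    {A : Set (E k × ℝ)} (hA : MeasurableSet A) (hAM : ∀ z ∈ A, z.1 ∈ M) :
    InjOn (perpAdd n) A ∧ MeasurableSet (perpAdd n '' A) ∧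
      volume (perpAdd n '' A) ≤ ∫⁻ s : ℝ, μHE[k - 1] {x | (x, s) ∈ A} ∧
      ∫⁻ s : ℝ, μHE[k - 1] {x | (x, s) ∈ A} ≤ (L : ℝ≥0∞) ^ (k - 1) * volume (perpAdd n '' A) := by
  have hinj : InjOn (perpAdd n) A := by
    intro z hz w hw h
    refine Prod.ext ?_ ?_
    · rw [← (hMW _ (hAM z hz)).2, ← (hMW _ (hAM w hw)).2, ← perp_perpAdd hn, ← perp_perpAdd hn, h]
    · rw [← inner_perpAdd hn z, ← inner_perpAdd hn w, h]
  have hmeas : MeasurableSet (perpAdd n '' A) :=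
    hA.image_of_continuousOn_injOn (perpAdd n).continuous.continuousOn hinj
  have hslice : ∀ s : ℝ, perpAdd n '' A ∩ {z | inner ℝ n z = s}
      = (fun x => perp n x + s • n) '' {x | (x, s) ∈ A} := by
    intro s
    ext z
    constructor
    · rintro ⟨⟨⟨x, t⟩, hx, rfl⟩, h⟩
      rw [mem_ofPred_eq, inner_perpAdd hn] at h
      simp only at h
      subst h
      exact ⟨x, hx, by simp⟩
    · rintro ⟨x, hx, rfl⟩
      refine ⟨⟨(x, s), hx, by simp⟩, ?_⟩
      have := inner_perpAdd hn (x, s)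
      rwa [perpAdd_apply] at this
  refine ⟨hinj, hmeas, ?_, ?_⟩
  · rw [volume_eq_lintegral_slices hn hmeas]
    refine lintegral_mono fun s => ?_
    rw [hslice]
    -- Projection of a slice to the hyperplane does not increase distances, which gives the upper
    -- volume bound. The inverse `Ψ ∘ perp n` is `L`-Lipschitz, which gives the other bound with the
    -- slice dimension `k - 1` as exponent.
    have hlip : LipschitzOnWith 1 (fun x => perp n x + s • n) {x | (x, s) ∈ A} := by
      refine LipschitzOnWith.of_dist_le_mul fun x _ y _ => ?_
      rw [dist_add_right, dist_eq_norm, ← map_sub, NNReal.coe_one, one_mul, dist_eq_norm]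
      exact norm_perp_le hn _
    simpa using hlip.euclideanHausdorffMeasure_image_le (k - 1)
  · rw [volume_eq_lintegral_slices hn hmeas, ← lintegral_const_mul' _ _ (by simp)]
    refine lintegral_mono fun s => ?_
    have hP : ∀ x, perp n (perp n x + s • n) = perp n x := fun x => by
      simpa using perp_perpAdd hn (x, s)
    have himg : {x | (x, s) ∈ A} = (Ψ ∘ perp n) '' (perpAdd n '' A ∩ {z | inner ℝ n z = s}) := by
      rw [hslice, image_image]
      ext x
      constructor
      · intro hx
        exact ⟨x, hx, by simp only [Function.comp, hP]; exact (hMW x (hAM _ hx)).2⟩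
      · rintro ⟨x', hx', rfl⟩
        simp only [Function.comp, hP]
        rw [(hMW x' (hAM _ hx')).2]
        exact hx'
    have hlip : LipschitzOnWith L (Ψ ∘ perp n) (perpAdd n '' A ∩ {z | inner ℝ n z = s}) := by
      rw [hslice]
      refine LipschitzOnWith.of_dist_le_mul ?_
      rintro _ ⟨x, hx, rfl⟩ _ ⟨y, hy, rfl⟩
      simp only [Function.comp, hP]
      refine (hL.dist_le_mul _ (hMW x (hAM _ hx)).1 _ (hMW y (hAM _ hy)).1).trans ?_
      rw [dist_add_right]
    conv_lhs => rw [himg]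
    exact hlip.euclideanHausdorffMeasure_image_le (k - 1)

/-- A version of the graph chart with a Lipschitz constant close to `1`. -/
theorem IsC2Domain.exists_lipschitz_chart (hD : IsC2Domain D) (hp : p ∈ frontier D) {L : ℝ≥0}
    (hL : 1 < L) :
    ∃ (Ψ : E k → E k) (V W : Set (E k)), ContDiffAt ℝ 1 Ψ (perp (outwardNormal D p) p) ∧
      HasFDerivAt Ψ (ContinuousLinearMap.id ℝ (E k)) (perp (outwardNormal D p) p) ∧
      IsOpen V ∧ p ∈ V ∧ LipschitzOnWith L Ψ W ∧
      ∀ x ∈ V ∩ frontier D, perp (outwardNormal D p) x ∈ W ∧ Ψ (perp (outwardNormal D p) x) = x := by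
  obtain ⟨Ψ, hΨ, hΨ', hinv, -⟩ := hD.exists_graph_chart hp
  have hs := hΨ.hasStrictFDerivAt' hΨ' (by norm_num)
  obtain ⟨W, hW, hWL⟩ := hs.exists_lipschitzOnWith_of_nnnorm_lt L
    (lt_of_le_of_lt (by exact_mod_cast ContinuousLinearMap.norm_id_le) hL)
  have hV : ∀ᶠ x in 𝓝 p, perp (outwardNormal D p) x ∈ W ∧
      (x ∈ frontier D → Ψ (perp (outwardNormal D p) x) = x) :=
    (((perp (outwardNormal D p)).continuous.tendsto p).eventually hW).and hinv
  obtain ⟨V, hVs, hVo, hpV⟩ := eventually_nhds_iff.mp hV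
  exact ⟨Ψ, V, W, hΨ, hΨ', hVo, hpV, hWL, fun x hx => ⟨(hVs x hx.1).1, (hVs x hx.1).2 hx.2⟩⟩

/-- The surface measure of the boundary is locally finite. -/
theorem IsC2Domain.isLocallyFiniteMeasure (hD : IsC2Domain D) :
    IsLocallyFiniteMeasure ((μHE[k - 1] : Measure (E k)).restrict (frontier D)) := by
  refine ⟨fun p => ?_⟩
  by_cases hp : p ∈ frontier D
  · obtain ⟨Ψ, V, W, -, -, hVo, hpV, hWL, hVW⟩ := hD.exists_lipschitz_chart hp one_lt_two
    set n := outwardNormal D p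
    have hn : ‖n‖ = 1 := hD.norm_outwardNormal hp
    let V' := V ∩ Metric.ball p 1
    have hV'o : IsOpen V' := hVo.inter Metric.isOpen_ball
    refine ⟨V', hV'o.mem_nhds ⟨hpV, Metric.mem_ball_self one_pos⟩, ?_⟩
    rw [Measure.restrict_apply hV'o.measurableSet]
    -- Thickening by the unit interval turns the surface measure of the patch into the slice
    -- integral, which is at most a constant times the volume of a bounded set.
    have h := (lintegral_slices_le hn hWL (M := V' ∩ frontier D) (A := (V' ∩ frontier D) ×ˢ Ioo 0 1)
      (fun x hx => hVW x ⟨hx.1.1, hx.2⟩)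
      ((hV'o.measurableSet.inter isClosed_frontier.measurableSet).prod measurableSet_Ioo)
      (fun z hz => hz.1)).2.2.2
    have hbdd : Bornology.IsBounded (perpAdd n '' ((V' ∩ frontier D) ×ˢ Ioo 0 1)) := by
      refine ((perpAdd n).lipschitz.isBounded_image ?_)
      refine (Bornology.IsBounded.prod ?_ (Metric.isBounded_Ioo 0 1))
      exact Metric.isBounded_ball.subset fun x hx => hx.1.2
    have h1 : ∫⁻ s : ℝ, μHE[k - 1] {x | (x, s) ∈ (V' ∩ frontier D) ×ˢ Ioo (0 : ℝ) 1}
        = μHE[k - 1] (V' ∩ frontier D) := by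
      have h2 : ∀ s : ℝ, μHE[k - 1] {x | (x, s) ∈ (V' ∩ frontier D) ×ˢ Ioo (0 : ℝ) 1}
          = (Ioo (0 : ℝ) 1).indicator (fun _ => μHE[k - 1] (V' ∩ frontier D)) s := by
        intro s
        by_cases hs : s ∈ Ioo (0 : ℝ) 1
        · rw [indicator_of_mem hs]
          congr 1
          ext x
          exact ⟨fun hx => hx.1, fun hx => ⟨hx, hs⟩⟩
        · rw [indicator_of_notMem hs]
          refine measure_mono_null (t := ∅) (fun x hx => hs hx.2) measure_empty
      simp_rw [h2]
      rw [lintegral_indicator measurableSet_Ioo, setLIntegral_const, Real.volume_Ioo]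
      simp
    rw [h1] at h
    exact h.trans_lt (ENNReal.mul_lt_top (by simp) hbdd.measure_lt_top)
  · refine ⟨(frontier D)ᶜ, isClosed_frontier.isOpen_compl.mem_nhds hp, ?_⟩
    rw [Measure.restrict_apply isClosed_frontier.measurableSet.compl, compl_inter_self]
    simp

end TubeExpansion

namespace TubeExpansion

variable {k : ℕ} {D : Set (E k)} {p x y : E k} {r s t : ℝ}

/-! ### The area formula for the normal exponential map -/

/-- The normal exponential map, read in a graph chart, has Jacobian determinant close to
`tubeJacobian` near a given point. -/
theorem IsC2Domain.exists_local_coordinates (hD : IsC2Domain D) (hp : p ∈ frontier D)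
    {Ψ : E k → E k} {V : Set (E k)} (hΨ : ContDiffAt ℝ 1 Ψ (perp (outwardNormal D p) p))
    (hΨ' : HasFDerivAt Ψ (ContinuousLinearMap.id ℝ (E k)) (perp (outwardNormal D p) p))
    (hVo : IsOpen V) (hpV : p ∈ V)
    (hV : ∀ x ∈ V ∩ frontier D, Ψ (perp (outwardNormal D p) x) = x) (t : ℝ) {e : ℝ} (he : 0 < e) :
    ∃ F : E k → E k, ∀ᶠ z : E k × ℝ in 𝓝 (p, t), z.1 ∈ V ∧
      DifferentiableAt ℝ F (perpAdd (outwardNormal D p) z) ∧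
      |(fderiv ℝ F (perpAdd (outwardNormal D p) z)).det - tubeJacobian D (p, t)| < e ∧
      (z.1 ∈ frontier D → F (perpAdd (outwardNormal D p) z) = normalExp D z) := by
  obtain ⟨N, hN, heq⟩ := hD.exists_normal_extension hp
  set n := outwardNormal D p with hndef
  have hn : ‖n‖ = 1 := hD.norm_outwardNormal hp
  have hNp : N p = n := (heq.self_of_nhds hp).symm
  have hΨp : Ψ (perp n p) = p := hV p ⟨hpV, hp⟩
  have hPp : perp n (perpAdd n (p, t)) = perp n p := perp_perpAdd hn _
  -- `F` is the normal exponential map read in the coordinates `perpAdd n`, with `N` in place of `ν`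
  -- so that it is defined and `C¹` on an open set.
  let F : E k → E k := fun z => Ψ (perp n z) + inner ℝ n z • N (Ψ (perp n z))
  have hΨ1 : ContDiffAt ℝ 1 (fun z => Ψ (perp n z)) (perpAdd n (p, t)) := by
    have h : ContDiffAt ℝ 1 Ψ (perp n (perpAdd n (p, t))) := by rwa [hPp]
    exact h.comp _ (perp n).contDiff.contDiffAt
  have hN1 : ContDiffAt ℝ 1 (fun z => N (Ψ (perp n z))) (perpAdd n (p, t)) := by
    have h : ContDiffAt ℝ 1 N (Ψ (perp n (perpAdd n (p, t)))) := by rwa [hPp, hΨp]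
    exact ContDiffAt.comp (g := N) _ h hΨ1
  have hin : ContDiffAt ℝ 1 (fun z : E k => (inner ℝ n z : ℝ)) (perpAdd n (p, t)) :=
    (innerSL ℝ n).contDiff.contDiffAt
  have hF : ContDiffAt ℝ 1 F (perpAdd n (p, t)) := hΨ1.add (hin.smul hN1)
  have hF' : HasFDerivAt F (ContinuousLinearMap.id ℝ (E k) + t • (fderiv ℝ N p ∘L perp n))
      (perpAdd n (p, t)) := by
    have h1 : HasFDerivAt (fun z => Ψ (perp n z)) (perp n) (perpAdd n (p, t)) := by
      have h : HasFDerivAt Ψ (ContinuousLinearMap.id ℝ (E k)) (perp n (perpAdd n (p, t))) := by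
        rwa [hPp]
      exact (h.comp _ (perp n).hasFDerivAt).congr_fderiv (ContinuousLinearMap.id_comp _)
    have h2 : HasFDerivAt (fun z => N (Ψ (perp n z))) (fderiv ℝ N p ∘L perp n)
        (perpAdd n (p, t)) := by
      have h : HasFDerivAt N (fderiv ℝ N p) (Ψ (perp n (perpAdd n (p, t)))) := by
        rw [hPp, hΨp]
        exact (hN.differentiableAt (by norm_num)).hasFDerivAt
      exact HasFDerivAt.comp (g := N) _ h h1
    have h3 : HasFDerivAt (fun z : E k => (inner ℝ n z : ℝ)) (innerSL ℝ n) (perpAdd n (p, t)) :=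
      (innerSL ℝ n).hasFDerivAt
    refine (h1.add (h3.smul h2)).congr_fderiv ?_
    ext1 v
    rw [inner_perpAdd hn, hPp, hΨp, hNp]
    simp
  refine ⟨F, ?_⟩
  have hc : Tendsto (perpAdd n) (𝓝 (p, t)) (𝓝 (perpAdd n (p, t))) :=
    (perpAdd n).continuous.tendsto _
  have hdiff : ∀ᶠ z in 𝓝 (perpAdd n (p, t)), DifferentiableAt ℝ F z := by
    filter_upwards [hF.eventually (by simp)] with z hz using hz.differentiableAt (by norm_num)
  have hdet : ∀ᶠ z in 𝓝 (perpAdd n (p, t)),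
      |(fderiv ℝ F z).det - tubeJacobian D (p, t)| < e := by
    have h1 : ContinuousAt (fun z => (fderiv ℝ F z).det) (perpAdd n (p, t)) :=
      ContinuousLinearMap.continuous_det.continuousAt.comp
        (hF.fderiv_right (m := 0) (by norm_num)).continuousAt
    have h2 : (fderiv ℝ F (perpAdd n (p, t))).det = tubeJacobian D (p, t) := by
      rw [hF'.fderiv, hD.tubeJacobian_eq hp (hN.differentiableAt (by norm_num)) heq, hNp]
    have h3 := h1.tendsto.eventually (Metric.ball_mem_nhds _ he)
    filter_upwards [h3] with z hz
    rw [← h2, ← Real.dist_eq]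
    exact hz
  have hfst : Tendsto Prod.fst (𝓝 (p, t)) (𝓝 p) := continuous_fst.tendsto _
  filter_upwards [hfst.eventually (hVo.mem_nhds hpV), hc.eventually hdiff, hc.eventually hdet,
    hfst.eventually heq] with z h1 h2 h3 h4
  refine ⟨h1, h2, h3, fun hz => ?_⟩
  simp only [F]
  rw [perp_perpAdd hn, inner_perpAdd hn, hV _ ⟨h1, hz⟩, ← h4 hz, normalExp]

/-- The product of the surface measure of the boundary and Lebesgue measure on the line. -/
noncomputable def boundaryProd (D : Set (E k)) : Measure (E k × ℝ) :=
  ((μHE[k - 1] : Measure (E k)).restrict (frontier D)).prod volume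

/-- Flattening by `perpAdd` distorts the product measure by a factor between `1` and `L ^ (k - 1)`.
The remaining map `F` is injective with Jacobian within `ε / 2` of the value at `(p, t)`, so the
Euclidean change of variables gives both bounds. -/
theorem IsC2Domain.exists_nhds_volume_image (hD : IsC2Domain D) (hp : p ∈ frontier D)
    (hrc : ENNReal.ofReal r < criticalRadius D) (ht : t ∈ Ioc 0 r) {ε : ℝ≥0} (hε : 0 < ε) :
    ∃ U ∈ 𝓝 (p, t), ∀ A ⊆ U ∩ frontier D ×ˢ Ioc 0 r, MeasurableSet A →
      volume (normalExp D '' A) ≤ ((tubeJacobian D (p, t)).toNNReal + ε) * boundaryProd D A ∧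
      (tubeJacobian D (p, t)).toNNReal * boundaryProd D A
        ≤ volume (normalExp D '' A) + ε * boundaryProd D A := by
  have hc0 : 0 ≤ tubeJacobian D (p, t) :=
    hD.tubeJacobian_nonneg hp ht.1 ((ENNReal.ofReal_le_ofReal ht.2).trans_lt hrc)
  obtain ⟨c, hc⟩ : ∃ c : ℝ≥0, tubeJacobian D (p, t) = c := ⟨⟨_, hc0⟩, rfl⟩
  -- Half of `ε` absorbs the distortion `L ^ (k - 1)` of the chart, the other half the variation of
  -- the Jacobian.
  obtain ⟨L, hL, hcL⟩ : ∃ L : ℝ≥0, 1 < L ∧ c * L ^ (k - 1) ≤ c + ε / 2 := by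
    have h1 : Tendsto (fun L : ℝ≥0 => c * L ^ (k - 1)) (𝓝[>] 1) (𝓝 (c * 1 ^ (k - 1))) :=
      (Continuous.tendsto (by fun_prop) 1).mono_left nhdsWithin_le_nhds
    have h2 : c * 1 ^ (k - 1) < c + ε / 2 := by
      rw [one_pow, mul_one]
      exact lt_add_of_pos_right _ (half_pos hε)
    obtain ⟨L, h3, h4⟩ := ((h1.eventually_lt_const h2).and self_mem_nhdsWithin).exists
    exact ⟨L, h4, h3.le⟩
  obtain ⟨Ψ, V, W, hΨ, hΨ', hVo, hpV, hWL, hVW⟩ := hD.exists_lipschitz_chart hp hL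
  obtain ⟨F, hF⟩ := hD.exists_local_coordinates hp hΨ hΨ' hVo hpV (fun x hx => (hVW x hx).2) t
    (e := ((ε / 2 : ℝ≥0) : ℝ)) (by exact_mod_cast half_pos hε)
  set n := outwardNormal D p with hndef
  have hn : ‖n‖ = 1 := hD.norm_outwardNormal hp
  have := hD.isLocallyFiniteMeasure
  refine ⟨_, hF, fun A hA hAm => ?_⟩
  rw [hc, Real.toNNReal_coe]
  rw [hc] at hA
  obtain ⟨hinj, hBm, hB1, hB2⟩ := lintegral_slices_le hn hWL hVW hAm
    (fun z hz => ⟨(hA hz).1.1, (hA hz).2.1⟩)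
  set B := perpAdd n '' A with hB
  have hm : boundaryProd D A = ∫⁻ s : ℝ, μHE[k - 1] {x | (x, s) ∈ A} := by
    rw [boundaryProd, Measure.prod_apply_symm hAm]
    refine lintegral_congr fun s => ?_
    rw [Measure.restrict_apply (measurable_prodMk_right hAm)]
    congr 1
    ext x
    exact ⟨fun hx => hx.1, fun hx => ⟨hx, (hA hx).2.1⟩⟩
  rw [← hm] at hB1 hB2
  have himg : normalExp D '' A = F '' B := by
    rw [hB, image_image]
    exact image_congr fun z hz => ((hA hz).1.2.2.2 (hA hz).2.1).symm
  have hFinj : InjOn F B := by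
    rintro _ ⟨z, hz, rfl⟩ _ ⟨w, hw, rfl⟩ h
    rw [(hA hz).1.2.2.2 (hA hz).2.1, (hA hw).1.2.2.2 (hA hw).2.1] at h
    rw [hD.injOn_normalExp hrc (hA hz).2 (hA hw).2 h]
  have hFd : ∀ z ∈ B, HasFDerivWithinAt F (fderiv ℝ F z) B z := by
    rintro _ ⟨z, hz, rfl⟩
    exact (hA hz).1.2.1.hasFDerivAt.hasFDerivWithinAt
  have hvol := lintegral_abs_det_fderiv_eq_addHaar_image volume hBm hFd hFinj
  rw [himg, ← hvol]
  have hup : ∀ z ∈ B, ENNReal.ofReal |(fderiv ℝ F z).det| ≤ c + (ε / 2 : ℝ≥0) := by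
    rintro _ ⟨z, hz, rfl⟩
    have h1 := (hA hz).1.2.2.1
    rw [← ENNReal.coe_add, ENNReal.ofReal_le_coe, NNReal.coe_add, abs_le]
    rw [abs_lt] at h1
    have := c.coe_nonneg
    constructor <;> linarith
  have hlo : ∀ z ∈ B, (c : ℝ≥0∞) ≤ ENNReal.ofReal |(fderiv ℝ F z).det| + (ε / 2 : ℝ≥0) := by
    rintro _ ⟨z, hz, rfl⟩
    have h1 := (hA hz).1.2.2.1
    rw [abs_lt] at h1
    rw [← ENNReal.ofReal_coe_nnreal, ← ENNReal.ofReal_coe_nnreal, ← ENNReal.ofReal_add (abs_nonneg _)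
      (NNReal.coe_nonneg _)]
    refine ENNReal.ofReal_le_ofReal ?_
    linarith [le_abs_self (fderiv ℝ F (perpAdd n z)).det]
  have hεε : ((ε / 2 : ℝ≥0) : ℝ≥0∞) + (ε / 2 : ℝ≥0) = ε := by
    rw [← ENNReal.coe_add, add_halves]
  constructor
  · calc ∫⁻ z in B, ENNReal.ofReal |(fderiv ℝ F z).det|
        ≤ ∫⁻ _ in B, (c + (ε / 2 : ℝ≥0) : ℝ≥0∞) := setLIntegral_mono measurable_const hup
      _ = (c + (ε / 2 : ℝ≥0)) * volume B := setLIntegral_const _ _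
      _ ≤ (c + ε) * boundaryProd D A := by
        gcongr
        exact_mod_cast half_le_self ε.2
  · have h1 : (c : ℝ≥0∞) * volume B ≤
        (∫⁻ z in B, ENNReal.ofReal |(fderiv ℝ F z).det|) + (ε / 2 : ℝ≥0) * volume B := by
      rw [← setLIntegral_const, ← setLIntegral_const, ← lintegral_add_right _ measurable_const]
      refine setLIntegral_mono' hBm hlo
    calc (c : ℝ≥0∞) * boundaryProd D A ≤ c * ((L : ℝ≥0∞) ^ (k - 1) * volume B) := by gcongr
      _ = ((c * L ^ (k - 1) : ℝ≥0) : ℝ≥0∞) * volume B := by push_cast; ring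
      _ ≤ ((c + ε / 2 : ℝ≥0) : ℝ≥0∞) * volume B := by gcongr
      _ = c * volume B + (ε / 2 : ℝ≥0) * volume B := by rw [ENNReal.coe_add, add_mul]
      _ ≤ ((∫⁻ z in B, ENNReal.ofReal |(fderiv ℝ F z).det|) + (ε / 2 : ℝ≥0) * volume B)
          + (ε / 2 : ℝ≥0) * volume B := by gcongr
      _ = (∫⁻ z in B, ENNReal.ofReal |(fderiv ℝ F z).det|) + ε * volume B := by
        rw [add_assoc, ← add_mul, hεε]
      _ ≤ _ := by gcongr

theorem IsC2Domain.measurableEmbedding_normalExp (hD : IsC2Domain D)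
    (hrc : ENNReal.ofReal r < criticalRadius D) :
    MeasurableEmbedding ((frontier D ×ˢ Ioc 0 r).domRestrict (normalExp D)) := by
  refine ContinuousOn.measurableEmbedding (isClosed_frontier.measurableSet.prod measurableSet_Ioc)
    ?_ (hD.injOn_normalExp hrc)
  have h1 : ContinuousOn (fun z : E k × ℝ => outwardNormal D z.1) (frontier D ×ˢ Ioc 0 r) :=
    hD.continuousOn_outwardNormal.comp continuousOn_fst fun z hz => hz.1
  exact continuousOn_fst.add (continuousOn_snd.smul h1)

/-- The change of variables formula for the normal exponential map. -/
theorem IsC2Domain.setIntegral_tube_diff (hD : IsC2Domain D)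
    (hrc : ENNReal.ofReal r < criticalRadius D) (φ : E k → ℝ) :
    ∫ y in tube D r \ D, φ y
      = ∫ z in frontier D ×ˢ Ioc 0 r, tubeJacobian D z * φ (normalExp D z) ∂boundaryProd D := by
  set S : Set (E k × ℝ) := frontier D ×ˢ Ioc 0 r with hS
  have hSm : MeasurableSet S := isClosed_frontier.measurableSet.prod measurableSet_Ioc
  have hemb := hD.measurableEmbedding_normalExp hrc
  have hval : MeasurableEmbedding (Subtype.val : S → E k × ℝ) := MeasurableEmbedding.subtype_coe hSm
  have hlf := hD.isLocallyFiniteMeasure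
  have hlf2 : IsLocallyFiniteMeasure (boundaryProd D) := by
    unfold boundaryProd; infer_instance
  -- Both measures are pulled back to the parameter space `S`, where the local estimates identify
  -- the Jacobian as the density of `ν` with respect to `μ`.
  let μ : Measure S := (boundaryProd D).comap Subtype.val
  let ν : Measure S := volume.comap (S.domRestrict (normalExp D))
  have hμlf : IsLocallyFiniteMeasure μ := by
    refine ⟨fun z => ?_⟩
    obtain ⟨U, hU, hUf⟩ := (boundaryProd D).finiteAt_nhds z.1
    refine ⟨Subtype.val ⁻¹' U, continuous_subtype_val.continuousAt.preimage_mem_nhds hU, ?_⟩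
    rw [hval.comap_apply]
    exact (measure_mono (image_preimage_subset _ _)).trans_lt hUf
  let ρ : S → ℝ≥0 := fun z => (tubeJacobian D z.1).toNNReal
  have hρ : Continuous ρ := by
    refine continuous_real_toNNReal.comp ?_
    exact continuousOn_iff_continuous_domRestrict.mp
      (hD.continuousOn_tubeJacobian.mono fun z hz => ⟨hz.1, mem_univ _⟩)
  have hνμ : ν = μ.withDensity fun z => ρ z := by
    refine Measure.eq_withDensity_of_forall_nhds hρ fun z ε hε => ?_
    obtain ⟨U, hU, hUA⟩ := hD.exists_nhds_volume_image (p := z.1.1) (t := z.1.2) z.2.1 hrc z.2.2 hε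
    refine ⟨Subtype.val ⁻¹' U, continuous_subtype_val.continuousAt.preimage_mem_nhds hU,
      fun A hA hAm => ?_⟩
    have h1 := hUA (Subtype.val '' A) (by
      rintro _ ⟨w, hw, rfl⟩
      exact ⟨hA hw, w.2⟩) (hval.measurableSet_image' hAm)
    rw [image_image] at h1
    have h2 : ν A = volume ((fun z : S => normalExp D z) '' A) := hemb.comap_apply volume A
    have h3 : μ A = boundaryProd D (Subtype.val '' A) := hval.comap_apply _ A
    rw [h2, h3]
    exact h1
  have hrange : range (S.domRestrict (normalExp D)) = tube D r \ D := by
    rw [range_domRestrict, hD.image_normalExp hrc]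
  rw [← hrange, ← hemb.map_comap, hemb.integral_map]
  change ∫ z, φ (normalExp D z) ∂ν = _
  rw [hνμ, integral_withDensity_eq_integral_smul hρ.measurable,
    ← integral_subtype_comap hSm]
  refine integral_congr_ae (Eventually.of_forall fun z => ?_)
  have h4 : 0 ≤ tubeJacobian D z.1 := hD.tubeJacobian_nonneg (p := z.1.1) (t := z.1.2) z.2.1 z.2.2.1
    ((ENNReal.ofReal_le_ofReal z.2.2.2).trans_lt hrc)
  simp only [ρ, NNReal.smul_def, Real.coe_toNNReal _ h4, smul_eq_mul]

end TubeExpansion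

namespace TubeExpansion

variable {k : ℕ} {D : Set (E k)} {p x y : E k} {r s t : ℝ}

/-! ### Decay and Taylor expansion of Schwartz functions -/

/-- Uniformity over shifts `‖v‖ ≤ 1` is what the intermediate points of the Taylor remainder along a
normal need; it holds since `‖x‖ ≤ 1 + ‖x + v‖`. -/
theorem _root_.SchwartzMap.exists_norm_iteratedFDeriv_add_le (φ : 𝓢(E k, ℝ)) (i : ℕ) {β : ℝ} (hβ : 0 < β) :
    ∃ C : ℝ, 0 ≤ C ∧ ∀ x v : E k, ‖v‖ ≤ 1 →
      ‖iteratedFDeriv ℝ i φ (x + v)‖ ≤ C * (1 / (1 + ‖x‖ ^ β)) := by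
  obtain ⟨b, hb⟩ := exists_nat_ge β
  let C₀ := 2 ^ b * (Finset.Iic (b, i)).sup (fun m => SchwartzMap.seminorm ℝ m.1 m.2) φ
  have hC₀ : ∀ x, (1 + ‖x‖) ^ b * ‖iteratedFDeriv ℝ i φ x‖ ≤ C₀ := fun x =>
    SchwartzMap.one_add_le_sup_seminorm_apply (𝕜 := ℝ) (m := (b, i)) le_rfl le_rfl φ x
  have hC0 : 0 ≤ C₀ := le_trans (by positivity) (hC₀ 0)
  refine ⟨2 * C₀, by positivity, fun x v hv => ?_⟩
  have hxβ : 0 ≤ ‖x‖ ^ β := Real.rpow_nonneg (norm_nonneg x) β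
  rw [mul_one_div, le_div_iff₀ (by positivity)]
  have hx : ‖x‖ ≤ 1 + ‖x + v‖ := by
    have := norm_sub_le (x + v) v
    rw [add_sub_cancel_right] at this
    linarith
  have h1 : (1 : ℝ) ≤ 1 + ‖x + v‖ := le_add_of_nonneg_right (norm_nonneg _)
  have h2 : ‖x‖ ^ β ≤ (1 + ‖x + v‖) ^ b := by
    refine (Real.rpow_le_rpow (norm_nonneg x) hx hβ.le).trans ?_
    rw [← Real.rpow_natCast]
    exact Real.rpow_le_rpow_of_exponent_le h1 hb
  have h3 : 1 ≤ (1 + ‖x + v‖) ^ b := one_le_pow₀ h1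
  calc ‖iteratedFDeriv ℝ i φ (x + v)‖ * (1 + ‖x‖ ^ β)
      ≤ ‖iteratedFDeriv ℝ i φ (x + v)‖ * (2 * (1 + ‖x + v‖) ^ b) := by gcongr; linarith
    _ = 2 * ((1 + ‖x + v‖) ^ b * ‖iteratedFDeriv ℝ i φ (x + v)‖) := by ring
    _ ≤ 2 * C₀ := by gcongr; exact hC₀ _

theorem _root_.SchwartzMap.exists_taylor_bound (φ : 𝓢(E k, ℝ)) (N : ℕ) {β : ℝ} (hβ : 0 < β) :
    ∃ C : ℝ, 0 ≤ C ∧ ∀ (x ν : E k) (t : ℝ), ‖ν‖ = 1 → 0 ≤ t → t ≤ 1 →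
      |φ (x + t • ν) - ∑ i ∈ Finset.range (N + 1),
        t ^ i / (i.factorial : ℝ) * iteratedFDeriv ℝ i φ x (fun _ => ν)|
        ≤ C * t ^ (N + 1) * (1 / (1 + ‖x‖ ^ β)) := by
  obtain ⟨C, hC0, hC⟩ := φ.exists_norm_iteratedFDeriv_add_le (N + 1) hβ
  refine ⟨C, hC0, fun x ν t hν ht0 ht1 => ?_⟩
  have hsmul : ∀ (i : ℕ) (y : E k), iteratedFDeriv ℝ i φ y (fun _ => t • ν)
      = t ^ i * iteratedFDeriv ℝ i φ y (fun _ => ν) := fun i y => by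
    simpa using (iteratedFDeriv ℝ i φ y).map_smul_univ (fun _ => t) (fun _ => ν)
  have h := map_add_eq_sum_add_integral_iteratedFDeriv (f := φ) (x := x) (y := t • ν) (n := N)
    fun s _ => (φ.smooth _).contDiffAt
  have hsum : ∑ i ∈ Finset.range (N + 1), (i.factorial : ℝ)⁻¹ •
      (iteratedFDeriv ℝ i φ x (fun _ => t • ν)) = ∑ i ∈ Finset.range (N + 1),
        t ^ i / (i.factorial : ℝ) * iteratedFDeriv ℝ i φ x (fun _ => ν) := by
    refine Finset.sum_congr rfl fun i _ => ?_
    rw [hsmul, smul_eq_mul]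
    ring
  rw [h, hsum, add_sub_cancel_left]
  have hq : 0 ≤ 1 / (1 + ‖x‖ ^ β) := by
    have := Real.rpow_nonneg (norm_nonneg x) β
    positivity
  have hbound : ∀ s ∈ uIoc (0 : ℝ) 1, ‖(1 - s) ^ N • iteratedFDeriv ℝ (N + 1) φ (x + s • t • ν)
      (fun _ => t • ν)‖ ≤ C * t ^ (N + 1) * (1 / (1 + ‖x‖ ^ β)) := by
    intro s hs
    rw [uIoc_of_le zero_le_one] at hs
    have h1 : ‖(1 - s) ^ N‖ ≤ 1 := by
      rw [norm_pow, Real.norm_eq_abs, abs_of_nonneg (by linarith [hs.2])]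
      exact pow_le_one₀ (by linarith [hs.2]) (by linarith [hs.1])
    have h2 : ‖s • t • ν‖ ≤ 1 := by
      rw [norm_smul, norm_smul, hν, mul_one, Real.norm_eq_abs, Real.norm_eq_abs,
        abs_of_nonneg hs.1.le, abs_of_nonneg ht0]
      exact mul_le_one₀ hs.2 ht0 ht1
    have h3 : ‖iteratedFDeriv ℝ (N + 1) φ (x + s • t • ν) (fun _ => ν)‖
        ≤ C * (1 / (1 + ‖x‖ ^ β)) := by
      refine le_trans ?_ (hC x _ h2)
      simpa [hν] using (iteratedFDeriv ℝ (N + 1) φ (x + s • t • ν)).le_opNorm (fun _ => ν)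
    rw [hsmul, norm_smul, norm_mul, norm_pow t, Real.norm_eq_abs t, abs_of_nonneg ht0]
    calc _ ≤ 1 * (t ^ (N + 1) * (C * (1 / (1 + ‖x‖ ^ β)))) := by gcongr
      _ = _ := by ring
  have h4 := intervalIntegral.norm_integral_le_of_norm_le_const hbound
  rw [sub_zero, abs_one, mul_one] at h4
  rw [smul_eq_mul, abs_mul, ← Real.norm_eq_abs (∫ _ in _.._, _)]
  have h5 : |((N.factorial : ℝ))⁻¹| ≤ 1 := by
    rw [abs_of_nonneg (by positivity)]
    exact inv_le_one_of_one_le₀ (by exact_mod_cast N.factorial_pos)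
  calc _ ≤ 1 * (C * t ^ (N + 1) * (1 / (1 + ‖x‖ ^ β))) := by gcongr
    _ = _ := one_mul _

/-! ### Integrability against the curvature measures -/

theorem finrank_tangentSpace (hD : IsC2Domain D) (hp : p ∈ frontier D) :
    Module.finrank ℝ (tangentSpace D p) + 1 = k := by
  have hn : outwardNormal D p ≠ 0 := by
    intro h
    simpa [h] using hD.norm_outwardNormal hp
  have h := (ℝ ∙ outwardNormal D p).finrank_add_finrank_orthogonal
  rw [finrank_span_singleton hn, finrank_euclideanSpace_fin] at h
  rw [tangentSpace]
  omega

theorem IsC2Domain.minkowskiDensity_eq_zero (hD : IsC2Domain D) (hp : p ∈ frontier D) {m : ℕ}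
    (hm : k ≤ m) : minkowskiDensity D (m + 1) p = 0 := by
  have := finrank_tangentSpace hD hp
  rw [minkowskiDensity, elemSymm_eq_zero _ (by omega), mul_zero]

/-- Steiner's polynomial: the tangent space has dimension `k - 1`, so `k` terms suffice, and the
factor `m!` in the density is compensated by `1 / m!`. -/
theorem IsC2Domain.tubeJacobian_eq_sum (hD : IsC2Domain D) (hp : p ∈ frontier D) (t : ℝ) :
    tubeJacobian D (p, t)
      = ∑ m ∈ Finset.range k, minkowskiDensity D (m + 1) p * (t ^ m / (m.factorial : ℝ)) := by
  rw [tubeJacobian, det_one_add_smul, finrank_tangentSpace hD hp]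
  refine Finset.sum_congr rfl fun m _ => ?_
  rw [minkowskiDensity]
  field_simp

theorem IsC2Domain.exists_integrable (hD : IsC2Domain D)
    (hcurv : ∀ j ≤ k, ∃ β : ℝ, 0 < β ∧ MinkowskiIntegrable D j (fun x => 1 / (1 + ‖x‖ ^ β)))
    (j : ℕ) : ∃ β : ℝ, 0 < β ∧ MinkowskiIntegrable D j (fun x => 1 / (1 + ‖x‖ ^ β)) := by
  rcases le_or_gt j k with hj | hj
  · exact hcurv j hj
  · refine ⟨1, one_pos, ?_⟩
    obtain ⟨m, rfl⟩ : ∃ m, j = m + 1 := ⟨j - 1, by omega⟩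
    refine (integrableOn_zero (s := frontier D)).congr_fun (fun x hx => ?_)
      isClosed_frontier.measurableSet
    rw [hD.minkowskiDensity_eq_zero hx (by omega), mul_zero]

/-- Measurability of the density comes from the integrability of its weighted version, by
multiplying the positive continuous weight away. -/
theorem MinkowskiIntegrable.aestronglyMeasurable {j : ℕ} {β : ℝ} (hβ : 0 < β)
    (h : MinkowskiIntegrable D j (fun x => 1 / (1 + ‖x‖ ^ β))) :
    AEStronglyMeasurable (minkowskiDensity D j) ((μHE[k - 1]).restrict (frontier D)) := by
  have hc : Continuous fun x : E k => 1 + ‖x‖ ^ β :=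
    continuous_const.add (continuous_norm.rpow_const fun _ => Or.inr hβ.le)
  refine (hc.aestronglyMeasurable.mul (Integrable.aestronglyMeasurable h)).congr (Eventually.of_forall fun x => ?_)
  have : 1 + ‖x‖ ^ β ≠ 0 := by
    have := Real.rpow_nonneg (norm_nonneg x) β
    positivity
  simp only [Pi.mul_apply]
  field_simp

theorem MinkowskiIntegrable.mono {j : ℕ} {β C : ℝ} (hβ : 0 < β)
    (h : MinkowskiIntegrable D j (fun x => 1 / (1 + ‖x‖ ^ β))) {g : E k → ℝ}
    (hg : ContinuousOn g (frontier D)) (hle : ∀ x ∈ frontier D, |g x| ≤ C * (1 / (1 + ‖x‖ ^ β))) :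
    MinkowskiIntegrable D j g := by
  refine Integrable.mono' (h.norm.const_mul C)
    ((hg.aestronglyMeasurable isClosed_frontier.measurableSet).mul (h.aestronglyMeasurable hβ)) ?_
  filter_upwards [ae_restrict_mem isClosed_frontier.measurableSet] with x hx
  have hq : 0 ≤ 1 / (1 + ‖x‖ ^ β) := by
    have := Real.rpow_nonneg (norm_nonneg x) β
    positivity
  rw [norm_mul, norm_mul, Real.norm_eq_abs (1 / _), abs_of_nonneg hq, ← mul_assoc]
  gcongr
  exact hle x hx

theorem IsC2Domain.continuousOn_normalDeriv (hD : IsC2Domain D) (φ : 𝓢(E k, ℝ)) (i : ℕ) :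
    ContinuousOn (normalDeriv D φ i) (frontier D) := by
  have h1 : Continuous (iteratedFDeriv ℝ i φ) :=
    (φ.smooth ⊤).continuous_iteratedFDeriv (by exact_mod_cast le_top)
  have h2 : Continuous fun q : (E k [×i]→L[ℝ] ℝ) × E k => q.1 fun _ => q.2 := by fun_prop
  exact h2.comp_continuousOn (h1.continuousOn.prodMk hD.continuousOn_outwardNormal)

theorem IsC2Domain.minkowskiIntegrable_normalDeriv (hD : IsC2Domain D)
    (hcurv : ∀ j ≤ k, ∃ β : ℝ, 0 < β ∧ MinkowskiIntegrable D j (fun x => 1 / (1 + ‖x‖ ^ β)))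
    (φ : 𝓢(E k, ℝ)) (i j : ℕ) : MinkowskiIntegrable D j (normalDeriv D φ i) := by
  obtain ⟨β, hβ, h⟩ := hD.exists_integrable hcurv j
  obtain ⟨C, -, hC⟩ := φ.exists_norm_iteratedFDeriv_add_le i hβ
  refine h.mono hβ (hD.continuousOn_normalDeriv φ i) (C := C) fun x hx => ?_
  have h1 := hC x 0 (by simp)
  rw [add_zero] at h1
  refine le_trans ?_ h1
  simpa [normalDeriv, hD.norm_outwardNormal hx] using
    (iteratedFDeriv ℝ i φ x).le_opNorm (fun _ => outwardNormal D x)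

end TubeExpansion

namespace TubeExpansion

variable {k : ℕ} {D : Set (E k)} {p x y : E k} {r s t : ℝ}

/-! ### The expansion of the tube integral -/

theorem boundaryProd_restrict (hD : IsC2Domain D) (r : ℝ) :
    (boundaryProd D).restrict (frontier D ×ˢ Ioc 0 r)
      = ((μHE[k - 1] : Measure (E k)).restrict (frontier D)).prod (volume.restrict (Ioc 0 r)) := by
  have := hD.isLocallyFiniteMeasure
  rw [boundaryProd, ← Measure.prod_restrict, Measure.restrict_restrict isClosed_frontier.measurableSet,
    inter_self]

theorem setIntegral_Ioc_pow (hr : 0 ≤ r) (n : ℕ) : ∫ t in Ioc 0 r, t ^ n = r ^ (n + 1) / (n + 1) := by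
  rw [← intervalIntegral.integral_of_le hr, integral_pow]
  simp

/-- Contribution of one curvature measure: the Taylor error, of order `t ^ (N + 1)`, times `t ^ m`
integrates over `(0, r]` to order `r ^ (m + N + 2)`. Fubini separates the Taylor terms into a
boundary integral and a power of `r`. -/
theorem IsC2Domain.exists_expansion_term (hD : IsC2Domain D)
    (hcurv : ∀ j ≤ k, ∃ β : ℝ, 0 < β ∧ MinkowskiIntegrable D j (fun x => 1 / (1 + ‖x‖ ^ β)))
    (φ : 𝓢(E k, ℝ)) (m N : ℕ) : ∃ K : ℝ, 0 ≤ K ∧ ∀ r : ℝ, 0 < r → r < 1 →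
      IntegrableOn (fun z : E k × ℝ => minkowskiDensity D (m + 1) z.1 * (z.2 ^ m / (m.factorial : ℝ))
        * φ (normalExp D z)) (frontier D ×ˢ Ioc 0 r) (boundaryProd D) ∧
      |(∫ z in frontier D ×ˢ Ioc 0 r, minkowskiDensity D (m + 1) z.1 * (z.2 ^ m / (m.factorial : ℝ))
          * φ (normalExp D z) ∂boundaryProd D)
        - ∑ i ∈ Finset.range (N + 1), r ^ (m + i + 1) / ((m + i + 1) * m.factorial * i.factorial)
          * minkowskiIntegral D (m + 1) (normalDeriv D φ i)| ≤ K * r ^ (m + N + 2) := by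
  have hlf := hD.isLocallyFiniteMeasure
  obtain ⟨β, hβ, hQ⟩ := hD.exists_integrable hcurv (m + 1)
  obtain ⟨C₀, hC₀0, hC₀⟩ := φ.exists_norm_iteratedFDeriv_add_le 0 hβ
  obtain ⟨C, hC0, hC⟩ := φ.exists_taylor_bound N hβ
  set σ : Measure (E k) := (μHE[k - 1]).restrict (frontier D) with hσ
  set W := minkowskiDensity D (m + 1) with hW
  let Q : E k → ℝ := fun x => 1 / (1 + ‖x‖ ^ β) * W x
  have hQi : Integrable Q σ := hQ
  have hq : ∀ x : E k, 0 ≤ 1 / (1 + ‖x‖ ^ β) := fun x => by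
    have := Real.rpow_nonneg (norm_nonneg x) β
    positivity
  have hQabs : ∀ x, |Q x| = 1 / (1 + ‖x‖ ^ β) * |W x| := fun x => by
    rw [abs_mul, abs_of_nonneg (hq x)]
  have hWm : AEStronglyMeasurable W σ := hQ.aestronglyMeasurable hβ
  have hfac : (0 : ℝ) < m.factorial := by exact_mod_cast m.factorial_pos
  refine ⟨C * ∫ x, |Q x| ∂σ, mul_nonneg hC0 (integral_nonneg fun x => abs_nonneg _),
    fun r hr hr1 => ?_⟩
  set S : Set (E k × ℝ) := frontier D ×ˢ Ioc 0 r with hS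
  have hSm : MeasurableSet S := isClosed_frontier.measurableSet.prod measurableSet_Ioc
  have hprod : (boundaryProd D).restrict S = σ.prod (volume.restrict (Ioc 0 r)) :=
    boundaryProd_restrict hD r
  let G : E k × ℝ → ℝ := fun z => W z.1 * (z.2 ^ m / (m.factorial : ℝ)) * φ (normalExp D z)
  let T : ℕ → E k × ℝ → ℝ := fun i z =>
    normalDeriv D φ i z.1 * W z.1 * (z.2 ^ (m + i) / (m.factorial * i.factorial))
  have hnuc : ContinuousOn (normalExp D) S := by
    have h1 : ContinuousOn (fun z : E k × ℝ => outwardNormal D z.1) S :=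
      hD.continuousOn_outwardNormal.comp continuousOn_fst fun z hz => hz.1
    exact continuousOn_fst.add (continuousOn_snd.smul h1)
  have hpow : ∀ z ∈ S, |z.2 ^ m / (m.factorial : ℝ)| ≤ r ^ m := by
    rintro z ⟨-, hz⟩
    rw [abs_of_nonneg (div_nonneg (pow_nonneg hz.1.le _) hfac.le)]
    refine (div_le_self (pow_nonneg hz.1.le _) (by exact_mod_cast m.factorial_pos)).trans ?_
    exact pow_le_pow_left₀ hz.1.le hz.2 m
  have hdom : ∀ c : ℝ, Integrable (fun z : E k × ℝ => |Q z.1| * c) ((boundaryProd D).restrict S) := by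
    intro c
    rw [hprod]
    exact hQi.abs.mul_prod (integrable_const c)
  have hG : Integrable G ((boundaryProd D).restrict S) := by
    refine (hdom C₀).mono' ?_ ?_
    · have h1 : AEStronglyMeasurable (fun z : E k × ℝ => W z.1) ((boundaryProd D).restrict S) := by
        rw [hprod]; exact hWm.comp_fst
      have h2 : AEStronglyMeasurable (fun z : E k × ℝ => φ (normalExp D z))
          ((boundaryProd D).restrict S) :=
        (φ.continuous.comp_continuousOn hnuc).aestronglyMeasurable hSm
      exact (h1.mul (by fun_prop)).mul h2
    · filter_upwards [ae_restrict_mem hSm] with z hz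
      have h1 : |φ (normalExp D z)| ≤ C₀ * (1 / (1 + ‖z.1‖ ^ β)) := by
        have h2 := hC₀ z.1 (z.2 • outwardNormal D z.1) (by
          rw [norm_smul, hD.norm_outwardNormal hz.1, mul_one, Real.norm_eq_abs,
            abs_of_pos hz.2.1]
          exact hz.2.2.trans hr1.le)
        rwa [norm_iteratedFDeriv_zero] at h2
      rw [Real.norm_eq_abs, abs_mul, abs_mul, hQabs]
      calc |W z.1| * |z.2 ^ m / (m.factorial : ℝ)| * |φ (normalExp D z)|
          ≤ |W z.1| * 1 * (C₀ * (1 / (1 + ‖z.1‖ ^ β))) := by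
            gcongr
            exact (hpow z hz).trans (pow_le_one₀ hr.le hr1.le)
        _ = _ := by ring
  have hpowi : ∀ n : ℕ, Integrable (fun t : ℝ => t ^ n) (volume.restrict (Ioc 0 r)) := fun n =>
    ((continuous_pow n).integrableOn_Icc (a := 0) (b := r)).mono_set Ioc_subset_Icc_self
  have hT : ∀ i, Integrable (T i) ((boundaryProd D).restrict S) := by
    intro i
    rw [hprod]
    exact Integrable.mul_prod (hD.minkowskiIntegrable_normalDeriv hcurv φ i (m + 1))
      ((hpowi (m + i)).div_const _)
  have hTint : ∀ i, ∫ z, T i z ∂((boundaryProd D).restrict S)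
      = r ^ (m + i + 1) / ((m + i + 1) * m.factorial * i.factorial)
          * minkowskiIntegral D (m + 1) (normalDeriv D φ i) := by
    intro i
    rw [hprod, integral_prod_mul (fun x => normalDeriv D φ i x * W x)
      (fun t : ℝ => t ^ (m + i) / (m.factorial * i.factorial)), integral_div,
      setIntegral_Ioc_pow hr.le, minkowskiIntegral, mul_comm]
    push_cast
    rw [div_div, mul_assoc]
  refine ⟨hG, ?_⟩
  have hsum : ∑ i ∈ Finset.range (N + 1), r ^ (m + i + 1) / ((m + i + 1) * m.factorial * i.factorial)
      * minkowskiIntegral D (m + 1) (normalDeriv D φ i)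
      = ∫ z in S, ∑ i ∈ Finset.range (N + 1), T i z ∂boundaryProd D := by
    rw [integral_finsetSum _ fun i _ => hT i]
    exact Finset.sum_congr rfl fun i _ => (hTint i).symm
  rw [hsum, ← integral_sub hG (integrable_finsetSum _ fun i _ => hT i), ← Real.norm_eq_abs]
  have hle : ∀ᵐ z ∂((boundaryProd D).restrict S),
      ‖G z - ∑ i ∈ Finset.range (N + 1), T i z‖ ≤ |Q z.1| * (C * r ^ (m + N + 1)) := by
    filter_upwards [ae_restrict_mem hSm] with z hz
    have h1 := hC z.1 (outwardNormal D z.1) z.2 (hD.norm_outwardNormal hz.1) hz.2.1.le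
      (hz.2.2.trans hr1.le)
    have h2 : G z - ∑ i ∈ Finset.range (N + 1), T i z = W z.1 * (z.2 ^ m / (m.factorial : ℝ))
        * (φ (z.1 + z.2 • outwardNormal D z.1) - ∑ i ∈ Finset.range (N + 1),
          z.2 ^ i / (i.factorial : ℝ) * iteratedFDeriv ℝ i φ z.1 (fun _ => outwardNormal D z.1)) := by
      rw [mul_sub, Finset.mul_sum]
      congr 1
      refine Finset.sum_congr rfl fun i _ => ?_
      simp only [T, normalDeriv]
      rw [pow_add]
      field_simp
    have h3 : z.2 ^ (N + 1) ≤ r ^ (N + 1) := pow_le_pow_left₀ hz.2.1.le hz.2.2 _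
    have h4 := hq z.1
    rw [h2, Real.norm_eq_abs, abs_mul, abs_mul, hQabs]
    calc _ ≤ |W z.1| * r ^ m * (C * r ^ (N + 1) * (1 / (1 + ‖z.1‖ ^ β))) := by
          gcongr
          · exact hpow z hz
          · exact h1.trans (by gcongr)
      _ = _ := by ring
  refine (norm_integral_le_of_norm_le (hdom _) hle).trans ?_
  rw [hprod, integral_prod_mul (fun x => |Q x|) (fun _ : ℝ => C * r ^ (m + N + 1)), integral_const]
  simp only [measureReal_restrict_apply_univ, Real.volume_real_Ioc_of_le hr.le, sub_zero, smul_eq_mul]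
  refine le_of_eq ?_
  ring

/-- Reindexing by `l = m + i + 1`, where `(l - 1).choose m / l! = 1 / (l · m! · i!)`. -/
theorem tubeCoeff_sum_eq (φ : 𝓢(E k, ℝ)) (r : ℝ) (N : ℕ) :
    ∑ l ∈ Finset.Icc 1 N, r ^ l / (l.factorial : ℝ) * tubeCoeff D φ l
      = ∑ m ∈ Finset.range N, ∑ i ∈ Finset.range (N - m),
        r ^ (m + i + 1) / ((m + i + 1) * m.factorial * i.factorial)
          * minkowskiIntegral D (m + 1) (normalDeriv D φ i) := by
  rw [← Finset.sum_range_diag_flip N fun m i => r ^ (m + i + 1) /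
    (((m : ℝ) + i + 1) * m.factorial * i.factorial) * minkowskiIntegral D (m + 1) (normalDeriv D φ i),
    ← Finset.Ico_add_one_right_eq_Icc, Finset.sum_Ico_eq_sum_range, Nat.add_sub_cancel]
  refine Finset.sum_congr rfl fun l _ => ?_
  rw [tubeCoeff, Finset.mul_sum, add_comm 1 l, Nat.add_sub_cancel]
  refine Finset.sum_congr rfl fun m hm => ?_
  obtain ⟨i, rfl⟩ : ∃ i, l = m + i := ⟨l - m, by have := Finset.mem_range.mp hm; omega⟩
  rw [Nat.add_sub_cancel_left]
  have h1 : minkowskiIntegral D (m + 1) (fun x => ((m + i).choose m : ℝ) * normalDeriv D φ i x)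
      = ((m + i).choose m : ℝ) * minkowskiIntegral D (m + 1) (normalDeriv D φ i) := by
    rw [minkowskiIntegral, minkowskiIntegral, ← integral_const_mul]
    simp_rw [mul_assoc]
  have h2 : ((m + i).choose m : ℝ) * m.factorial * i.factorial = (m + i).factorial := by
    rw [Nat.choose_symm_add]
    exact_mod_cast (Nat.add_choose_mul_factorial_mul_factorial m i)
  have h3 : (0 : ℝ) < m.factorial := by exact_mod_cast m.factorial_pos
  have h4 : (0 : ℝ) < i.factorial := by exact_mod_cast i.factorial_pos
  have h5 : (0 : ℝ) < (m + i).factorial := by exact_mod_cast (m + i).factorial_pos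
  have h6 : (0 : ℝ) < (m + i + 1 : ℝ) := by positivity
  rw [h1, Nat.factorial_succ, ← mul_assoc]
  congr 1
  push_cast
  rw [div_mul_eq_mul_div, div_eq_div_iff (by positivity) (by positivity), ← h2]
  ring

theorem IsC2Domain.minkowskiIntegral_eq_zero (hD : IsC2Domain D) {m : ℕ} (hm : k ≤ m) (g : E k → ℝ) :
    minkowskiIntegral D (m + 1) g = 0 := by
  rw [minkowskiIntegral, setIntegral_congr_fun (g := fun _ => 0) isClosed_frontier.measurableSet
    fun x hx => by simp [hD.minkowskiDensity_eq_zero hx hm]]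
  simp

theorem IsC2Domain.integral_tube_sub (hD : IsC2Domain D) (hr : 0 ≤ r) (φ : 𝓢(E k, ℝ)) :
    (∫ x in tube D r, φ x) - ∫ x in D, φ x = ∫ x in tube D r \ D, φ x := by
  refine (setIntegral_sdiff hD.isClosed.measurableSet φ.integrable.integrableOn fun x hx => ?_).symm
  rw [tube, mem_ofPred_eq, Metric.infDist_zero_of_mem hx]
  exact hr

end TubeExpansion

theorem corollary3p3 {k : ℕ} (D : Set (TubeExpansion.E k))
    (hD : TubeExpansion.IsC2Domain D)
    (hrc : 0 < TubeExpansion.criticalRadius D)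
    (hcurv : ∀ j ≤ k, ∃ β : ℝ, 0 < β ∧
      TubeExpansion.MinkowskiIntegrable D j (fun x => 1 / (1 + ‖x‖ ^ β)))
    (φ : 𝓢(TubeExpansion.E k, ℝ)) :
    (∀ i j : ℕ, TubeExpansion.MinkowskiIntegrable D j (TubeExpansion.normalDeriv D φ i)) ∧
    ∀ n : ℕ, ∃ K : ℝ, ∀ r : ℝ, 0 < r → r < 1 →
      ENNReal.ofReal r < TubeExpansion.criticalRadius D →
      |(∫ x in TubeExpansion.tube D r, φ x) - (∫ x in D, φ x)
          - ∑ l ∈ Finset.Icc 1 (n + k), r ^ l / (l.factorial : ℝ) * TubeExpansion.tubeCoeff D φ l|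
        < r ^ (n + 2) / ((n + 2).factorial : ℝ) * K := by
  open TubeExpansion in
  refine ⟨hD.minkowskiIntegrable_normalDeriv hcurv φ, fun n => ?_⟩
  -- For `m < k` this Taylor order makes every remainder `r ^ (n + k + 1)`, which is at most `r ^ (n
  -- + 2)` because `k ≥ 1` and `r < 1`.
  choose K hK0 hK using fun m : ℕ => hD.exists_expansion_term hcurv φ m (n + k - m - 1)
  have hfac : (0 : ℝ) < (n + 2).factorial := by exact_mod_cast (n + 2).factorial_pos
  -- The added `1` makes the final inequality strict even if all the `K m` vanish.
  refine ⟨(n + 2).factorial * ∑ m ∈ Finset.range k, K m + 1, fun r hr hr1 hrlt => ?_⟩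
  have hint : ∫ x in tube D r \ D, φ x = ∑ m ∈ Finset.range k,
      ∫ z in frontier D ×ˢ Ioc 0 r, minkowskiDensity D (m + 1) z.1 * (z.2 ^ m / (m.factorial : ℝ))
        * φ (normalExp D z) ∂boundaryProd D := by
    rw [hD.setIntegral_tube_diff hrlt, ← integral_finsetSum _ fun m _ => (hK m r hr hr1).1]
    refine setIntegral_congr_fun (isClosed_frontier.measurableSet.prod measurableSet_Ioc) fun z hz => ?_
    rw [← Finset.sum_mul, ← hD.tubeJacobian_eq_sum hz.1]
  have hcoeff : ∑ l ∈ Finset.Icc 1 (n + k), r ^ l / (l.factorial : ℝ) * tubeCoeff D φ l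
      = ∑ m ∈ Finset.range k, ∑ i ∈ Finset.range (n + k - m - 1 + 1),
        r ^ (m + i + 1) / ((m + i + 1) * m.factorial * i.factorial)
          * minkowskiIntegral D (m + 1) (normalDeriv D φ i) := by
    -- The coefficients also involve indices `m ≥ k`, whose curvature densities vanish.
    rw [tubeCoeff_sum_eq, ← Finset.sum_subset (Finset.range_mono (Nat.le_add_left k n))]
    · refine Finset.sum_congr rfl fun m hm => ?_
      have := Finset.mem_range.mp hm
      rw [show n + k - m - 1 + 1 = n + k - m by omega]
    · intro m _ hm
      refine Finset.sum_eq_zero fun i _ => ?_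
      rw [hD.minkowskiIntegral_eq_zero (by simpa using hm), mul_zero]
  rw [hD.integral_tube_sub hr.le, hint, hcoeff, ← Finset.sum_sub_distrib]
  have hpos : 0 < r ^ (n + 2) := pow_pos hr _
  calc _ ≤ ∑ m ∈ Finset.range k, K m * r ^ (n + 2) := by
        refine (Finset.abs_sum_le_sum_abs _ _).trans (Finset.sum_le_sum fun m hm => ?_)
        refine ((hK m r hr hr1).2).trans ?_
        have := Finset.mem_range.mp hm
        exact mul_le_mul_of_nonneg_left (pow_le_pow_of_le_one hr.le hr1.le (by omega)) (hK0 m)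
    _ = r ^ (n + 2) / ((n + 2).factorial : ℝ) * ((n + 2).factorial * ∑ m ∈ Finset.range k, K m) := by
        rw [← Finset.sum_mul]
        field_simp
    _ < _ := by
        gcongr
        exact lt_add_one _
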